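/- \textbf{Language.} Consider the untyped call-by-value $\lambda$-calculus with values $u,v ::= () \mid n \mid x \mid l \mid f \mid \langle u,v\rangle$ ($n\in\mathbb Z$, $l$ a location, $f$ a function name, both from countably infinite sets) and expressions $e ::= v \mid \lambda x.e \mid e\,e' \mid \mathsf{if}\ e\ \mathsf{then}\ e_1\ \mathsf{else}\ e_2 \mid \langle e,e'\rangle \mid \pi_i(e) \mid \mathsf{ref}\,e \mid {!}e \mid e\ \mathsf{op}\ e' \mid \mathsf{emit}\,v$, where $\mathsf{op}$ is assignment, equality test, or $+,-,\times$ on integers. $\mathrm{Val}$ and $\mathrm{Exp}$ denote the closed values and expressions. A state is $s=(h,\gamma)$, with $h$ a finite map from locations to values (heap) and $\gamma$ a finite map from function names to $\lambda$-abstractions. Reduction takes place in left-to-right call-by-value evaluation contexts: $\lambda x.e$ reduces to a fresh name $f$ and is stored in $\gamma$ under $f$; $f\,v$ reduces to $e\{v/x\}$ if $\gamma(f)=\lambda x.e$; a conditional takes the first branch on a positive integer and the second on $0$; projections, allocation, lookup, assignment (to allocated locations), equality test (result $1$ or $0$) and arithmetic are standard; and $\mathsf{emit}\,v$ reduces to $()$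 with label $v$, all other steps being silent. Write $e,s\xrightarrow{t}{}^{*}e',s'$ for the reflexive transitive closure, $t\in\mathrm{Val}^*$ being the trace of labels, and $e,s\not\rightarrow$ if no step is possible. \textbf{Resources and worlds.} A resource is a pair $m=(h,\tau)$ of a heap and a trace resource $\tau\in\{\mathsf{hist}(t),\mathsf{trace}(t)\mid t\in\mathrm{Val}^*\}$. The partial product of resources is disjoint union on heaps and, on trace resources, $\mathsf{hist}(t_1)\bullet\mathsf{hist}(t_2)=\mathsf{hist}(\text{the longer of } t_1,t_2)$ if one is a prefix of the other, $\mathsf{trace}(t_1)\bullet\mathsf{hist}(t_2)=\mathsf{hist}(t_2)\bullet\mathsf{trace}(t_1)=\mathsf{trace}(t_1)$ if $t_2$ is a prefix of $t_1$, and undefined otherwise; $m\le m'$ means $m'=m\bullet m''$ for some $m''$. A world is a pair $w=(\gamma,I)$ of a function environment and a set $I$ of traces (the trace invariant); $(\gamma,I)\le(\gamma',I')$ iff $\gamma\subseteq\gamma'$ and $I=I'$. The relation $t,(h,\gamma)\vDash_{(\gamma',I)}(h',\tau)$ means $h=h'$, $\gamma=\gamma'$, $t\in I$, and $t=t'$ if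 $\tau=\mathsf{trace}(t')$, resp. $t'$ is a prefix of $t$ if $\tau=\mathsf{hist}(t')$. \textbf{Logic.} Terms $\Gamma\vdash M:\tau$ are those of the simply-typed higher-order logic over the types $1$, $\mathrm{Bool}$, $\mathrm{Nat}$, functions, products, finite sequences, $\mathrm{Prop}$ (assertions), $\mathrm{Spec}$ (specifications), $\mathrm{Val}$, $\mathrm{Exp}$, $\mathrm{Loc}$, with the term formers of the typed $\lambda$-calculus with pairs, Booleans and sequences (with fold), the intuitionistic connectives, quantifiers and equality, $\mathsf{emp}$, $*$, $-\!\!*$, $\mapsto$, Hoare triples $\{P\}\,e\,\{Q\}$ ($P:\mathrm{Prop}$, $e:\mathrm{Exp}$, $Q:\mathrm{Val}\to\mathrm{Prop}$), the embeddings $\mathsf{valid}:\mathrm{Prop}\to\mathrm{Spec}$ and $\mathsf{spec}:\mathrm{Spec}\to\mathrm{Prop}$, and $\mathsf{trace}(t)$, $\mathsf{hist}(t)$, $\mathsf{inv}(I)$; logical variables may occur as program variables in program expressions. A judgement $\Gamma\mid\Theta\vdash S$ (with $\Theta$ a finite list of assumed specifications) is derived by the usual rules of intuitionistic higher-order logic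 for specifications and of intuitionistic higher-order separation logic for assertions, the introduction and elimination rules for $\mathsf{valid}$ and $\mathsf{spec}$, duplicability of $\mathsf{inv}$ and $\mathsf{hist}$, the rules $\mathsf{trace}(t)\vdash\mathsf{trace}(t)*\mathsf{hist}(t)$ and $\mathsf{trace}(t_1)*\mathsf{hist}(t_2)\vdash\mathsf{trace}(t_1)*(t_2\text{ is a prefix of }t_1)$, and rules for triples: frame, consequence, bind, moving $\mathsf{spec}(S)$ between precondition and context, existential preconditions, and one rule per language construct; in particular from $\Gamma,x:\mathrm{Val}\mid\Theta\vdash\{P\}\,e\,\{Q\}$ one infers $\Gamma\mid\Theta\vdash\{\mathsf{emp}\}\,\lambda x.e\,\{r.\ \forall x:\mathrm{Val}.\,\mathsf{spec}(\{P\}\,r\,x\,\{Q\})\}$ (with $x$ not free in $\Theta$), and from $\Gamma\mid\Theta\vdash I(t\cdot v)$ one infers $\Gamma\mid\Theta\vdash\{\mathsf{trace}(t)*\mathsf{inv}(I)\}\ \mathsf{emit}\,v\ \{r.\ \mathsf{trace}(t\cdot v)*r=()\}$. Types are interpreted by sets, $[\![\mathrm{Prop}]\!]$ being the monotone functions from worlds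 to upward closed sets of resources and $[\![\mathrm{Spec}]\!]$ the monotone functions from worlds to $\{\bot<\top\}$; terms are interpreted under an environment $\rho\in[\![\Gamma]\!]$ by the Kripke semantics over worlds and resources, in which $\mathsf{emp}$ is true, $\mathsf{trace}(t)$ (resp. $\mathsf{hist}(t)$) holds of $(h,\tau)$ iff $\tau\ge\mathsf{trace}(t)$ (resp. $\tau\ge\mathsf{hist}(t)$), $\mathsf{inv}(I)$ holds at $w$ iff $I$ is the trace invariant of $w$, and $\{P\}\,e\,\{Q\}$ is interpreted at $w$ as $\forall w'\ge w.\ [\![P]\!]_\rho(w')\subseteq\mathsf{wp}([\![Q]\!]_\rho)(\rho(e))(w')$, where $\rho(e)$ is the closed expression that $e$ denotes under $\rho$ (its program variables being replaced according to $\rho$). Here $\mathsf{wp}(q)$ is the greatest fixed point $X$ such that $m\in X(e)(w)$ iff for all $r,t,s$ with $t,s\vDash_w m\bullet r$: if $e,s\not\rightarrow$ then $e\in\mathrm{Val}$ and $m\in q(e)(w)$; and whenever $e,s\xrightarrow{a}e',s'$, there are $w'\ge w$ and $m'\in X(e')(w')$ with $(t\cdot a),s'\vDash_{w'}m'\bullet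 r$. \textbf{Corollary.} Suppose $\Gamma\mid-\vdash\{P\}\,e\,\{Q\}$ is derivable (empty specification context). Let $w=(\gamma,I)$ be a world, $\rho\in[\![\Gamma]\!]$ and $m\in[\![P]\!]_\rho(w)$. Then for all traces $t,t'$, states $s,s'$ and expressions $e'$ such that $$t,s\vDash_w m\qquad\text{and}\qquad \rho(e),s\xrightarrow{t'}{}^{*}e',s'\not\rightarrow,$$ we have $e'\in\mathrm{Val}$, and there exist $w'\ge w$ and $m'\in[\![Q]\!]_\rho(e')(w')$ such that $(t\cdot t'),s'\vDash_{w'}m'$. In particular $t\cdot t'\in I$. -/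

import Mathlib

namespace TraceLogic

/-! ## The programming language

Variables are de Bruijn indices: `Val n` and `Exp k n` are the values and expressions whose free
(value) variables are among `n` given ones.  Since the logic also has variables ranging over
expressions, an expression may moreover contain `k` expression variables.  Programs that are run
are closed: `CVal = Val 0` and `CExp = Exp 0 0`. -/

/-- Values other than pairs: unit, integers, variables, locations, function names. -/
inductive Atom (n : ℕ) : Type
  | unit : Atom n
  | int (z : ℤ) : Atom n
  | var (i : Fin n) : Atom n
  | loc (l : ℕ) : Atom n
  | fn (f : ℕ) : Atom n

inductive Val (n : ℕ) : Type
  | atom (a : Atom n) : Val n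
  | pair (u v : Val n) : Val n

/-- Binary operators: assignment, equality test, integer arithmetic. -/
inductive Op : Type
  | assign | eq | add | sub | mul

/-- Expressions.  The argument of `emit` is a value; the values among the expressions are those in
the range of `Val.toExp`. -/
inductive Exp (k : ℕ) : ℕ → Type
  | atom {n : ℕ} (a : Atom n) : Exp k n
  | evar {n : ℕ} (j : Fin k) : Exp k n
  | lam {n : ℕ} (e : Exp k (n + 1)) : Exp k n
  | app {n : ℕ} (e e' : Exp k n) : Exp k n
  | ite {n : ℕ} (e e₁ e₂ : Exp k n) : Exp k n
  | pair {n : ℕ} (e e' : Exp k n) : Exp k n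
  | proj {n : ℕ} (i : Fin 2) (e : Exp k n) : Exp k n
  | ref {n : ℕ} (e : Exp k n) : Exp k n
  | deref {n : ℕ} (e : Exp k n) : Exp k n
  | op {n : ℕ} (o : Op) (e e' : Exp k n) : Exp k n
  | emit {n : ℕ} (v : Val n) : Exp k n

def Val.toExp {k n : ℕ} : Val n → Exp k n
  | .atom a => .atom a
  | .pair u v => .pair u.toExp v.toExp

abbrev CVal := Val 0
abbrev CExp := Exp 0 0

/-! ### Renaming and capture-avoiding simultaneous substitution -/

def Atom.subst {n m : ℕ} (σ : Fin n → Val m) : Atom n → Val m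
  | .unit => .atom .unit
  | .int z => .atom (.int z)
  | .var i => σ i
  | .loc l => .atom (.loc l)
  | .fn f => .atom (.fn f)

def Val.subst {n m : ℕ} (σ : Fin n → Val m) : Val n → Val m
  | .atom a => a.subst σ
  | .pair u v => .pair (u.subst σ) (v.subst σ)

def Val.rename {n m : ℕ} (ξ : Fin n → Fin m) (v : Val n) : Val m :=
  v.subst fun i => .atom (.var (ξ i))

/-- The extension of a renaming to one more bound variable. -/
def liftRen {n m : ℕ} (ξ : Fin n → Fin m) : Fin (n + 1) → Fin (m + 1) :=
  Fin.cons 0 fun i => (ξ i).succ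

def Exp.rename {k : ℕ} : {n m : ℕ} → (Fin n → Fin m) → Exp k n → Exp k m
  | _, _, ξ, .atom a => (a.subst fun i => .atom (.var (ξ i))).toExp
  | _, _, _, .evar j => .evar j
  | _, _, ξ, .lam e => .lam (e.rename (liftRen ξ))
  | _, _, ξ, .app e e' => .app (e.rename ξ) (e'.rename ξ)
  | _, _, ξ, .ite e e₁ e₂ => .ite (e.rename ξ) (e₁.rename ξ) (e₂.rename ξ)
  | _, _, ξ, .pair e e' => .pair (e.rename ξ) (e'.rename ξ)
  | _, _, ξ, .proj i e => .proj i (e.rename ξ)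
  | _, _, ξ, .ref e => .ref (e.rename ξ)
  | _, _, ξ, .deref e => .deref (e.rename ξ)
  | _, _, ξ, .op o e e' => .op o (e.rename ξ) (e'.rename ξ)
  | _, _, ξ, .emit v => .emit (v.rename ξ)

/-- The extension of a substitution of values to one more bound variable. -/
def liftSub {n m : ℕ} (σ : Fin n → Val m) : Fin (n + 1) → Val (m + 1) :=
  Fin.cons (.atom (.var 0)) fun i => (σ i).rename Fin.succ

/-- Simultaneous substitution of values for variables and of expressions for expression
variables. -/
def Exp.subst {k k' : ℕ} :
    {n m : ℕ} → (Fin n → Val m) → (Fin k → Exp k' m) → Exp k n → Exp k' m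
  | _, _, σ, _, .atom a => (a.subst σ).toExp
  | _, _, _, τ, .evar j => τ j
  | _, _, σ, τ, .lam e => .lam (e.subst (liftSub σ) fun j => (τ j).rename Fin.succ)
  | _, _, σ, τ, .app e e' => .app (e.subst σ τ) (e'.subst σ τ)
  | _, _, σ, τ, .ite e e₁ e₂ => .ite (e.subst σ τ) (e₁.subst σ τ) (e₂.subst σ τ)
  | _, _, σ, τ, .pair e e' => .pair (e.subst σ τ) (e'.subst σ τ)
  | _, _, σ, τ, .proj i e => .proj i (e.subst σ τ)
  | _, _, σ, τ, .ref e => .ref (e.subst σ τ)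
  | _, _, σ, τ, .deref e => .deref (e.subst σ τ)
  | _, _, σ, τ, .op o e e' => .op o (e.subst σ τ) (e'.subst σ τ)
  | _, _, σ, _, .emit v => .emit (v.subst σ)

/-- `e{v/x}`, for a body `e` with the single free variable `x`. -/
def Exp.inst (e : Exp 0 1) (v : CVal) : CExp := e.subst (fun _ => v) Fin.elim0

/-! ### Evaluation contexts -/

inductive ECtx (k n : ℕ) : Type
  | hole : ECtx k n
  | appL (K : ECtx k n) (e : Exp k n) : ECtx k n
  | appR (v : Val n) (K : ECtx k n) : ECtx k n
  | opL (o : Op) (K : ECtx k n) (e : Exp k n) : ECtx k n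
  | opR (o : Op) (v : Val n) (K : ECtx k n) : ECtx k n
  | ite (K : ECtx k n) (e₁ e₂ : Exp k n) : ECtx k n
  | pairL (K : ECtx k n) (e : Exp k n) : ECtx k n
  | pairR (v : Val n) (K : ECtx k n) : ECtx k n
  | proj (i : Fin 2) (K : ECtx k n) : ECtx k n
  | ref (K : ECtx k n) : ECtx k n
  | deref (K : ECtx k n) : ECtx k n

def ECtx.rename {k n m : ℕ} (ξ : Fin n → Fin m) : ECtx k n → ECtx k m
  | .hole => .hole
  | .appL K e => .appL (K.rename ξ) (e.rename ξ)
  | .appR v K => .appR (v.rename ξ) (K.rename ξ)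
  | .opL o K e => .opL o (K.rename ξ) (e.rename ξ)
  | .opR o v K => .opR o (v.rename ξ) (K.rename ξ)
  | .ite K e₁ e₂ => .ite (K.rename ξ) (e₁.rename ξ) (e₂.rename ξ)
  | .pairL K e => .pairL (K.rename ξ) (e.rename ξ)
  | .pairR v K => .pairR (v.rename ξ) (K.rename ξ)
  | .proj i K => .proj i (K.rename ξ)
  | .ref K => .ref (K.rename ξ)
  | .deref K => .deref (K.rename ξ)

def ECtx.fill {k n : ℕ} : ECtx k n → Exp k n → Exp k n
  | .hole, e => e
  | .appL K e', e => .app (K.fill e) e'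
  | .appR v K, e => .app v.toExp (K.fill e)
  | .opL o K e', e => .op o (K.fill e) e'
  | .opR o v K, e => .op o v.toExp (K.fill e)
  | .ite K e₁ e₂, e => .ite (K.fill e) e₁ e₂
  | .pairL K e', e => .pair (K.fill e) e'
  | .pairR v K, e => .pair v.toExp (K.fill e)
  | .proj i K, e => .proj i (K.fill e)
  | .ref K, e => .ref (K.fill e)
  | .deref K, e => .deref (K.fill e)

/-! ### Operational semantics -/

/-- Finite maps from locations to values. -/
abbrev Heap := Finmap fun _ : ℕ => CVal

/-- Finite maps from function names to `λ`-abstractions, each represented by its body. -/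
abbrev FEnv := Finmap fun _ : ℕ => Exp 0 1

abbrev State := Heap × FEnv

abbrev Trace := List CVal

/-- Reduction of redexes; the label `none` is the silent label `ε`. -/
inductive HeadStep : CExp → State → Option CVal → CExp → State → Prop
  | lam (e : Exp 0 1) (h : Heap) (γ : FEnv) (f : ℕ) (hf : f ∉ γ) :
      HeadStep (.lam e) (h, γ) none (.atom (.fn f)) (h, γ.insert f e)
  | app (f : ℕ) (v : CVal) (e : Exp 0 1) (h : Heap) (γ : FEnv) (hf : γ.lookup f = some e) :
      HeadStep (.app (.atom (.fn f)) v.toExp) (h, γ) none (e.inst v) (h, γ)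
  | proj (i : Fin 2) (v : Fin 2 → CVal) (s : State) :
      HeadStep (.proj i (.pair (v 0).toExp (v 1).toExp)) s none (v i).toExp s
  | itePos (n : ℤ) (hn : 0 < n) (e₁ e₂ : CExp) (s : State) :
      HeadStep (.ite (.atom (.int n)) e₁ e₂) s none e₁ s
  | iteZero (e₁ e₂ : CExp) (s : State) :
      HeadStep (.ite (.atom (.int 0)) e₁ e₂) s none e₂ s
  | ref (v : CVal) (h : Heap) (γ : FEnv) (l : ℕ) (hl : l ∉ h) :
      HeadStep (.ref v.toExp) (h, γ) none (.atom (.loc l)) (h.insert l v, γ)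
  | deref (l : ℕ) (v : CVal) (h : Heap) (γ : FEnv) (hl : h.lookup l = some v) :
      HeadStep (.deref (.atom (.loc l))) (h, γ) none v.toExp (h, γ)
  | assign (l : ℕ) (v : CVal) (h : Heap) (γ : FEnv) (hl : l ∈ h) :
      HeadStep (.op .assign (.atom (.loc l)) v.toExp) (h, γ) none (.atom .unit) (h.insert l v, γ)
  | eqTrue (v : CVal) (s : State) :
      HeadStep (.op .eq v.toExp v.toExp) s none (.atom (.int 1)) s
  | eqFalse (u v : CVal) (huv : u ≠ v) (s : State) :
      HeadStep (.op .eq u.toExp v.toExp) s none (.atom (.int 0)) s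
  | add (a b : ℤ) (s : State) :
      HeadStep (.op .add (.atom (.int a)) (.atom (.int b))) s none (.atom (.int (a + b))) s
  | sub (a b : ℤ) (s : State) :
      HeadStep (.op .sub (.atom (.int a)) (.atom (.int b))) s none (.atom (.int (a - b))) s
  | mul (a b : ℤ) (s : State) :
      HeadStep (.op .mul (.atom (.int a)) (.atom (.int b))) s none (.atom (.int (a * b))) s
  | emit (v : CVal) (s : State) :
      HeadStep (.emit v) s (some v) (.atom .unit) s

inductive Step : CExp → State → Option CVal → CExp → State → Prop
  | ctx (K : ECtx 0 0) {e e' : CExp} {s s' : State} {a : Option CVal} (h : HeadStep e s a e' s') :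
      Step (K.fill e) s a (K.fill e') s'

/-- The reflexive transitive closure of reduction, labelled by the trace of emitted events. -/
inductive Steps : CExp → State → Trace → CExp → State → Prop
  | refl (e : CExp) (s : State) : Steps e s [] e s
  | head {e e' e'' : CExp} {s s' s'' : State} {a : Option CVal} {t : Trace}
      (h : Step e s a e' s') (hs : Steps e' s' t e'' s'') : Steps e s (a.toList ++ t) e'' s''

def Irreducible (e : CExp) (s : State) : Prop := ∀ a e' s', ¬ Step e s a e' s'

/-! ## Resources and worlds -/

/-- Trace resources: `own t` grants the exclusive right to extend the current trace `t`, and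
`hist t` only records that `t` is a prefix of the current trace. -/
inductive TraceRes : Type
  | hist (t : Trace) : TraceRes
  | own (t : Trace) : TraceRes

/-- The graph of the partial multiplication of trace resources; `<+:` is the prefix order. -/
inductive TraceRes.Comp : TraceRes → TraceRes → TraceRes → Prop
  | histL {t₁ t₂ : Trace} (h : t₂ <+: t₁) : Comp (.hist t₁) (.hist t₂) (.hist t₁)
  | histR {t₁ t₂ : Trace} (h : t₁ <+: t₂) : Comp (.hist t₁) (.hist t₂) (.hist t₂)
  | ownL {t₁ t₂ : Trace} (h : t₂ <+: t₁) : Comp (.own t₁) (.hist t₂) (.own t₁)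
  | ownR {t₁ t₂ : Trace} (h : t₂ <+: t₁) : Comp (.hist t₂) (.own t₁) (.own t₁)

theorem TraceRes.Comp.assoc {a b ab c d : TraceRes} (h : Comp a b ab) (h' : Comp ab c d) :
    ∃ bc, Comp b c bc ∧ Comp a bc d := by
  cases h with
  | histL h =>
    cases h' with
    | histL h' =>
      rcases List.prefix_or_prefix_of_prefix h h' with k | k
      · exact ⟨_, .histR k, .histL h'⟩
      · exact ⟨_, .histL k, .histL h⟩
    | histR h' => exact ⟨_, .histR (h.trans h'), .histR h'⟩
    | ownR h' => exact ⟨_, .ownR (h.trans h'), .ownR h'⟩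
  | histR h =>
    cases h' with
    | histL h' => exact ⟨_, .histL h', .histR h⟩
    | histR h' => exact ⟨_, .histR h', .histR (h.trans h')⟩
    | ownR h' => exact ⟨_, .ownR h', .ownR (h.trans h')⟩
  | ownL h =>
    cases h' with
    | ownL h' =>
      rcases List.prefix_or_prefix_of_prefix h h' with k | k
      · exact ⟨_, .histR k, .ownL h'⟩
      · exact ⟨_, .histL k, .ownL h⟩
  | ownR h =>
    cases h' with
    | ownL h' => exact ⟨_, .ownL h', .ownR h⟩

theorem TraceRes.Comp.unit (a : TraceRes) : Comp a (.hist []) a := by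
  cases a with
  | hist t => exact .histL t.nil_prefix
  | own t => exact .ownL t.nil_prefix

instance : Preorder TraceRes where
  le a b := ∃ c, TraceRes.Comp a c b
  le_refl a := ⟨_, .unit a⟩
  le_trans _ _ _ := fun ⟨_, h⟩ ⟨_, h'⟩ => let ⟨_, _, k⟩ := h.assoc h'; ⟨_, k⟩

/-- The resource monoid: the product of heaps (under disjoint union) and trace resources. -/
structure Res : Type where
  heap : Heap
  tr : TraceRes

/-- The unit of the resource monoid. -/
def Res.unit : Res := ⟨∅, .hist []⟩

/-- `Res.Comp m₁ m₂ m`: the product of `m₁` and `m₂` is defined and equal to `m`. -/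
structure Res.Comp (m₁ m₂ m : Res) : Prop where
  disj : m₁.heap.Disjoint m₂.heap
  heap : m.heap = m₁.heap ∪ m₂.heap
  tr : TraceRes.Comp m₁.tr m₂.tr m.tr

theorem Res.Comp.assoc {a b ab c d : Res} (h : Comp a b ab) (h' : Comp ab c d) :
    ∃ bc, Comp b c bc ∧ Comp a bc d := by
  obtain ⟨x, hx, hx'⟩ := h.tr.assoc h'.tr
  have hd := h'.disj
  rw [h.heap, Finmap.disjoint_union_left] at hd
  exact ⟨⟨b.heap ∪ c.heap, x⟩, ⟨hd.2, rfl, hx⟩,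
    ⟨(Finmap.disjoint_union_right _ _ _).2 ⟨h.disj, hd.1⟩,
      by rw [h'.heap, h.heap, Finmap.union_assoc], hx'⟩⟩

theorem Res.Comp.unit (a : Res) : Comp a Res.unit a :=
  ⟨(Finmap.disjoint_empty _).symm, Finmap.union_empty.symm, .unit _⟩

instance : Preorder Res where
  le a b := ∃ c, Res.Comp a c b
  le_refl a := ⟨_, .unit a⟩
  le_trans _ _ _ := fun ⟨_, h⟩ ⟨_, h'⟩ => let ⟨_, _, k⟩ := h.assoc h'; ⟨_, k⟩

/-- Worlds: a function environment and a trace invariant. -/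
structure World : Type where
  env : FEnv
  inv : Set Trace

/-- The function environment may grow, the trace invariant stays the same. -/
instance : Preorder World where
  le w w' := (∀ f e, w.env.lookup f = some e → w'.env.lookup f = some e) ∧ w.inv = w'.inv
  le_refl _ := ⟨fun _ _ h => h, rfl⟩
  le_trans _ _ _ h h' := ⟨fun f e k => h'.1 f e (h.1 f e k), h.2.trans h'.2⟩

/-- The erasure relation `t, s ⊨_w m`. -/
def Erases (t : Trace) (s : State) (w : World) (m : Res) : Prop :=
  (match m.tr with
    | .own t' => t = t'
    | .hist t' => t' <+: t) ∧
  s.1 = m.heap ∧ s.2 = w.env ∧ t ∈ w.inv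

/-- The relation `t, s ⊨_w m • r`, which includes that `m • r` is defined. -/
def ErasesFrame (t : Trace) (s : State) (w : World) (m r : Res) : Prop :=
  ∃ c, Res.Comp m r c ∧ Erases t s w c

/-! ## Types and their interpretation -/

/-- The two sorts of formulas: resource assertions and specifications. -/
inductive Kind : Type
  | prop | spec

inductive Ty : Type
  | unit | bool | nat
  | fn (σ τ : Ty)
  | prod (σ τ : Ty)
  | seq (τ : Ty)
  | log (k : Kind)
  | val | exp | loc

abbrev Ty.prop : Ty := .log .prop
abbrev Ty.spec : Ty := .log .spec
abbrev Ty.trace : Ty := .seq .val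

/-- Assertions are evaluated at a world and a resource, specifications at a world. -/
abbrev Kind.Point : Kind → Type
  | .prop => World × Res
  | .spec => World

instance : (k : Kind) → Preorder k.Point
  | .prop => inferInstanceAs (Preorder (World × Res))
  | .spec => inferInstanceAs (Preorder World)

/-- The interpretation of types.  An upward closed set of pairs `(w, m)` is the same as a monotone
function from worlds to upward closed sets of resources, and an upward closed set of worlds is the
same as a monotone function from worlds to `{⊥ < ⊤}`. -/
abbrev Ty.denote : Ty → Type
  | .unit => Unit
  | .bool => Bool
  | .nat => ℕ
  | .fn σ τ => σ.denote → τ.denote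
  | .prod σ τ => σ.denote × τ.denote
  | .seq τ => List τ.denote
  | .log k => UpperSet k.Point
  | .val => CVal
  | .exp => CExp
  | .loc => ℕ

/-- Interpretations of assertions, and of specifications. -/
abbrev SProp := UpperSet (World × Res)
abbrev SSpec := UpperSet World

/-! ## Terms -/

/-- Variables of type `τ` in the term context `Γ`. -/
inductive Var : List Ty → Ty → Type
  | zero {Γ : List Ty} {τ : Ty} : Var (τ :: Γ) τ
  | succ {Γ : List Ty} {τ σ : Ty} (x : Var Γ τ) : Var (σ :: Γ) τ

/-- Well-typed terms `Γ ⊢ M : τ`.  The formula constructors are shared by assertions and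
specifications.  Program values and expressions occur in terms through `val v σ` and `exp e σ τ`,
where `σ` and `τ` instantiate the variables and the expression variables of the program by terms;
in particular the variables of the term context may be used as program variables.  `ofLoc` is the
inclusion of locations in values. -/
inductive Tm : List Ty → Ty → Type
  | var {Γ : List Ty} {τ : Ty} (x : Var Γ τ) : Tm Γ τ
  | lam {Γ : List Ty} {σ τ : Ty} (M : Tm (σ :: Γ) τ) : Tm Γ (.fn σ τ)
  | app {Γ : List Ty} {σ τ : Ty} (M : Tm Γ (.fn σ τ)) (N : Tm Γ σ) : Tm Γ τ
  | unit {Γ : List Ty} : Tm Γ .unit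
  | pair {Γ : List Ty} {σ τ : Ty} (M : Tm Γ σ) (N : Tm Γ τ) : Tm Γ (.prod σ τ)
  | fst {Γ : List Ty} {σ τ : Ty} (M : Tm Γ (.prod σ τ)) : Tm Γ σ
  | snd {Γ : List Ty} {σ τ : Ty} (M : Tm Γ (.prod σ τ)) : Tm Γ τ
  | bot {Γ : List Ty} {k : Kind} : Tm Γ (.log k)
  | top {Γ : List Ty} {k : Kind} : Tm Γ (.log k)
  | or {Γ : List Ty} {k : Kind} (P Q : Tm Γ (.log k)) : Tm Γ (.log k)
  | and {Γ : List Ty} {k : Kind} (P Q : Tm Γ (.log k)) : Tm Γ (.log k)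
  | imp {Γ : List Ty} {k : Kind} (P Q : Tm Γ (.log k)) : Tm Γ (.log k)
  | all {Γ : List Ty} {k : Kind} (τ : Ty) (P : Tm (τ :: Γ) (.log k)) : Tm Γ (.log k)
  | ex {Γ : List Ty} {k : Kind} (τ : Ty) (P : Tm (τ :: Γ) (.log k)) : Tm Γ (.log k)
  | eq {Γ : List Ty} {k : Kind} {τ : Ty} (M N : Tm Γ τ) : Tm Γ (.log k)
  | tt {Γ : List Ty} : Tm Γ .bool
  | ff {Γ : List Ty} : Tm Γ .bool
  | cond {Γ : List Ty} {τ : Ty} (M : Tm Γ .bool) (N₁ N₂ : Tm Γ τ) : Tm Γ τ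
  | valid {Γ : List Ty} (P : Tm Γ .prop) : Tm Γ .spec
  | emp {Γ : List Ty} : Tm Γ .prop
  | star {Γ : List Ty} (P Q : Tm Γ .prop) : Tm Γ .prop
  | wand {Γ : List Ty} (P Q : Tm Γ .prop) : Tm Γ .prop
  | pointsTo {Γ : List Ty} (M : Tm Γ .loc) (N : Tm Γ .val) : Tm Γ .prop
  | triple {Γ : List Ty} (P : Tm Γ .prop) (e : Tm Γ .exp) (Q : Tm Γ (.fn .val .prop)) : Tm Γ .spec
  | spec {Γ : List Ty} (S : Tm Γ .spec) : Tm Γ .prop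
  | nil {Γ : List Ty} {τ : Ty} : Tm Γ (.seq τ)
  | cons {Γ : List Ty} {τ : Ty} (M : Tm Γ τ) (N : Tm Γ (.seq τ)) : Tm Γ (.seq τ)
  | fold {Γ : List Ty} {σ τ : Ty} (M : Tm Γ (.seq τ)) (N₁ : Tm Γ σ)
      (N₂ : Tm Γ (.fn (.prod σ τ) σ)) : Tm Γ σ
  | trace {Γ : List Ty} (M : Tm Γ .trace) : Tm Γ .prop
  | hist {Γ : List Ty} (M : Tm Γ .trace) : Tm Γ .prop
  | inv {Γ : List Ty} (M : Tm Γ (.fn .trace .bool)) : Tm Γ .prop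
  | ofLoc {Γ : List Ty} (M : Tm Γ .loc) : Tm Γ .val
  | val {Γ : List Ty} {n : ℕ} (v : Val n) (σ : Fin n → Tm Γ .val) : Tm Γ .val
  | exp {Γ : List Ty} {k n : ℕ} (e : Exp k n) (σ : Fin n → Tm Γ .val) (τ : Fin k → Tm Γ .exp) :
      Tm Γ .exp

/-! ### Renaming and substitution of term variables -/

abbrev Ren (Γ Δ : List Ty) := (τ : Ty) → Var Γ τ → Var Δ τ
abbrev Sub (Γ Δ : List Ty) := (τ : Ty) → Var Γ τ → Tm Δ τ

def Ren.lift {Γ Δ : List Ty} {σ : Ty} (ξ : Ren Γ Δ) : Ren (σ :: Γ) (σ :: Δ)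
  | _, .zero => .zero
  | _, .succ x => .succ (ξ _ x)

def Tm.rename : {Γ Δ : List Ty} → {τ : Ty} → Ren Γ Δ → Tm Γ τ → Tm Δ τ
  | _, _, _, ξ, .var x => .var (ξ _ x)
  | _, _, _, ξ, .lam M => .lam (M.rename ξ.lift)
  | _, _, _, ξ, .app M N => .app (M.rename ξ) (N.rename ξ)
  | _, _, _, _, .unit => .unit
  | _, _, _, ξ, .pair M N => .pair (M.rename ξ) (N.rename ξ)
  | _, _, _, ξ, .fst M => .fst (M.rename ξ)
  | _, _, _, ξ, .snd M => .snd (M.rename ξ)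
  | _, _, _, _, .bot => .bot
  | _, _, _, _, .top => .top
  | _, _, _, ξ, .or P Q => .or (P.rename ξ) (Q.rename ξ)
  | _, _, _, ξ, .and P Q => .and (P.rename ξ) (Q.rename ξ)
  | _, _, _, ξ, .imp P Q => .imp (P.rename ξ) (Q.rename ξ)
  | _, _, _, ξ, .all τ P => .all τ (P.rename ξ.lift)
  | _, _, _, ξ, .ex τ P => .ex τ (P.rename ξ.lift)
  | _, _, _, ξ, .eq M N => .eq (M.rename ξ) (N.rename ξ)
  | _, _, _, _, .tt => .tt
  | _, _, _, _, .ff => .ff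
  | _, _, _, ξ, .cond M N₁ N₂ => .cond (M.rename ξ) (N₁.rename ξ) (N₂.rename ξ)
  | _, _, _, ξ, .valid P => .valid (P.rename ξ)
  | _, _, _, _, .emp => .emp
  | _, _, _, ξ, .star P Q => .star (P.rename ξ) (Q.rename ξ)
  | _, _, _, ξ, .wand P Q => .wand (P.rename ξ) (Q.rename ξ)
  | _, _, _, ξ, .pointsTo M N => .pointsTo (M.rename ξ) (N.rename ξ)
  | _, _, _, ξ, .triple P e Q => .triple (P.rename ξ) (e.rename ξ) (Q.rename ξ)
  | _, _, _, ξ, .spec S => .spec (S.rename ξ)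
  | _, _, _, _, .nil => .nil
  | _, _, _, ξ, .cons M N => .cons (M.rename ξ) (N.rename ξ)
  | _, _, _, ξ, .fold M N₁ N₂ => .fold (M.rename ξ) (N₁.rename ξ) (N₂.rename ξ)
  | _, _, _, ξ, .trace M => .trace (M.rename ξ)
  | _, _, _, ξ, .hist M => .hist (M.rename ξ)
  | _, _, _, ξ, .inv M => .inv (M.rename ξ)
  | _, _, _, ξ, .ofLoc M => .ofLoc (M.rename ξ)
  | _, _, _, ξ, .val v σ => .val v fun i => (σ i).rename ξ
  | _, _, _, ξ, .exp e σ τ => .exp e (fun i => (σ i).rename ξ) fun j => (τ j).rename ξ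

/-- Weakening by one variable. -/
def Ren.wk {Γ : List Ty} {σ : Ty} : Ren Γ (σ :: Γ) := fun _ x => .succ x

abbrev Tm.wk {Γ : List Ty} {σ τ : Ty} (M : Tm Γ τ) : Tm (σ :: Γ) τ := M.rename Ren.wk

/-- Weakening by a variable placed just below the most recent one. -/
abbrev Tm.wk₁ {Γ : List Ty} {σ σ' τ : Ty} (M : Tm (σ :: Γ) τ) : Tm (σ :: σ' :: Γ) τ :=
  M.rename Ren.wk.lift

def Sub.lift {Γ Δ : List Ty} {σ : Ty} (θ : Sub Γ Δ) : Sub (σ :: Γ) (σ :: Δ)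
  | _, .zero => .var .zero
  | _, .succ x => (θ _ x).wk

def Tm.subst : {Γ Δ : List Ty} → {τ : Ty} → Sub Γ Δ → Tm Γ τ → Tm Δ τ
  | _, _, _, θ, .var x => θ _ x
  | _, _, _, θ, .lam M => .lam (M.subst θ.lift)
  | _, _, _, θ, .app M N => .app (M.subst θ) (N.subst θ)
  | _, _, _, _, .unit => .unit
  | _, _, _, θ, .pair M N => .pair (M.subst θ) (N.subst θ)
  | _, _, _, θ, .fst M => .fst (M.subst θ)
  | _, _, _, θ, .snd M => .snd (M.subst θ)
  | _, _, _, _, .bot => .bot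
  | _, _, _, _, .top => .top
  | _, _, _, θ, .or P Q => .or (P.subst θ) (Q.subst θ)
  | _, _, _, θ, .and P Q => .and (P.subst θ) (Q.subst θ)
  | _, _, _, θ, .imp P Q => .imp (P.subst θ) (Q.subst θ)
  | _, _, _, θ, .all τ P => .all τ (P.subst θ.lift)
  | _, _, _, θ, .ex τ P => .ex τ (P.subst θ.lift)
  | _, _, _, θ, .eq M N => .eq (M.subst θ) (N.subst θ)
  | _, _, _, _, .tt => .tt
  | _, _, _, _, .ff => .ff
  | _, _, _, θ, .cond M N₁ N₂ => .cond (M.subst θ) (N₁.subst θ) (N₂.subst θ)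
  | _, _, _, θ, .valid P => .valid (P.subst θ)
  | _, _, _, _, .emp => .emp
  | _, _, _, θ, .star P Q => .star (P.subst θ) (Q.subst θ)
  | _, _, _, θ, .wand P Q => .wand (P.subst θ) (Q.subst θ)
  | _, _, _, θ, .pointsTo M N => .pointsTo (M.subst θ) (N.subst θ)
  | _, _, _, θ, .triple P e Q => .triple (P.subst θ) (e.subst θ) (Q.subst θ)
  | _, _, _, θ, .spec S => .spec (S.subst θ)
  | _, _, _, _, .nil => .nil
  | _, _, _, θ, .cons M N => .cons (M.subst θ) (N.subst θ)
  | _, _, _, θ, .fold M N₁ N₂ => .fold (M.subst θ) (N₁.subst θ) (N₂.subst θ)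
  | _, _, _, θ, .trace M => .trace (M.subst θ)
  | _, _, _, θ, .hist M => .hist (M.subst θ)
  | _, _, _, θ, .inv M => .inv (M.subst θ)
  | _, _, _, θ, .ofLoc M => .ofLoc (M.subst θ)
  | _, _, _, θ, .val v σ => .val v fun i => (σ i).subst θ
  | _, _, _, θ, .exp e σ τ => .exp e (fun i => (σ i).subst θ) fun j => (τ j).subst θ

/-- The substitution of `M` for the most recent variable. -/
def Sub.one {Γ : List Ty} {σ : Ty} (M : Tm Γ σ) : Sub (σ :: Γ) Γ
  | _, .zero => M
  | _, .succ x => .var x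

abbrev Tm.inst {Γ : List Ty} {σ τ : Ty} (N : Tm (σ :: Γ) τ) (M : Tm Γ σ) : Tm Γ τ :=
  N.subst (Sub.one M)

/-! ### Abbreviations -/

/-- The most recent variable, and the one before it. -/
abbrev v₀ {Γ : List Ty} {τ : Ty} : Tm (τ :: Γ) τ := .var .zero
abbrev v₁ {Γ : List Ty} {σ τ : Ty} : Tm (σ :: τ :: Γ) τ := .var (.succ .zero)

/-- Concatenation of sequences. -/
def Tm.append {Γ : List Ty} {τ : Ty} (M N : Tm Γ (.seq τ)) : Tm Γ (.seq τ) :=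
  .fold M N (.lam (.cons (.snd v₀) (.fst v₀)))

/-- `M · N`, the sequence `M` extended by the element `N`. -/
def Tm.snoc {Γ : List Ty} {τ : Ty} (M : Tm Γ (.seq τ)) (N : Tm Γ τ) : Tm Γ (.seq τ) :=
  M.append (.cons N .nil)

/-- The prefix order on sequences. -/
def Tm.pref {Γ : List Ty} {k : Kind} {τ : Ty} (M N : Tm Γ (.seq τ)) : Tm Γ (.log k) :=
  .ex (.seq τ) (.eq (M.wk.append v₀) N.wk)

/-- Closed program values as terms. -/
def Tm.const {Γ : List Ty} (v : CVal) : Tm Γ .val := .val v Fin.elim0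

/-- A term of type `val`, used as a program expression. -/
def Tm.ret {Γ : List Ty} (V : Tm Γ .val) : Tm Γ .exp :=
  .exp (k := 0) (n := 1) (.atom (.var 0)) ![V] Fin.elim0

/-! ## Semantics of terms -/

abbrev Env (Γ : List Ty) := (τ : Ty) → Var Γ τ → τ.denote

def Env.cons {Γ : List Ty} {σ : Ty} (a : σ.denote) (ρ : Env Γ) : Env (σ :: Γ)
  | _, .zero => a
  | _, .succ x => ρ _ x

/-- The functional whose greatest fixed point is the weakest precondition. -/
def wpStep (Q : CVal → SProp) (X : CExp → World → Set Res) : CExp → World → Set Res :=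
  fun e w => {m | ∀ (r : Res) (t : Trace) (s : State), ErasesFrame t s w m r →
    (Irreducible e s → ∃ v : CVal, e = v.toExp ∧ (w, m) ∈ Q v) ∧
    ∀ (a : Option CVal) (e' : CExp) (s' : State), Step e s a e' s' →
      ∃ w' ≥ w, ∃ m', ErasesFrame (t ++ a.toList) s' w' m' r ∧ m' ∈ X e' w'}

theorem wpStep_mono (Q : CVal → SProp) : Monotone (wpStep Q) := by
  intro X Y hXY e w m hm r t s hs
  refine ⟨(hm r t s hs).1, fun a e' s' h => ?_⟩
  obtain ⟨w', hw', m', h₁, h₂⟩ := (hm r t s hs).2 a e' s' h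
  exact ⟨w', hw', m', h₁, hXY e' w' h₂⟩

/-- The weakest precondition `wp(Q)(e)(w)`. -/
def wp (Q : CVal → SProp) : CExp → World → Set Res :=
  OrderHom.gfp ⟨wpStep Q, wpStep_mono Q⟩

def semImp {α : Type} [Preorder α] (P Q : UpperSet α) : UpperSet α where
  carrier := {p | ∀ q, p ≤ q → q ∈ P → q ∈ Q}
  upper' := fun _ _ h hp q hq => hp q (h.trans hq)

def semAnd {α : Type} [Preorder α] (P Q : UpperSet α) : UpperSet α where
  carrier := {p | p ∈ P ∧ p ∈ Q}
  upper' := fun _ _ h hp => ⟨P.upper h hp.1, Q.upper h hp.2⟩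

def semOr {α : Type} [Preorder α] (P Q : UpperSet α) : UpperSet α where
  carrier := {p | p ∈ P ∨ p ∈ Q}
  upper' := fun _ _ h hp => hp.imp (fun k => P.upper h k) (fun k => Q.upper h k)

def semAll {α ι : Type} [Preorder α] (P : ι → UpperSet α) : UpperSet α where
  carrier := {p | ∀ i, p ∈ P i}
  upper' := fun _ _ h hp i => (P i).upper h (hp i)

def semEx {α ι : Type} [Preorder α] (P : ι → UpperSet α) : UpperSet α where
  carrier := {p | ∃ i, p ∈ P i}
  upper' := fun _ _ h ⟨i, hp⟩ => ⟨i, (P i).upper h hp⟩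

/-- A formula whose truth does not depend on the world and the resource. -/
def semPure {α : Type} [Preorder α] (φ : Prop) : UpperSet α where
  carrier := {_p | φ}
  upper' := fun _ _ _ h => h

def semStar (P Q : SProp) : SProp where
  carrier := {p | ∃ m₁ m₂, (p.1, m₁) ∈ P ∧ (p.1, m₂) ∈ Q ∧ Res.Comp m₁ m₂ p.2}
  upper' := by
    rintro ⟨w, m⟩ ⟨w', m'⟩ ⟨hw, x, hx⟩ ⟨m₁, m₂, h₁, h₂, h⟩
    obtain ⟨y, hy, hy'⟩ := h.assoc hx
    exact ⟨m₁, y, P.upper (a := (w, m₁)) ⟨hw, le_rfl⟩ h₁,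
      Q.upper (a := (w, m₂)) ⟨hw, x, hy⟩ h₂, hy'⟩

def semWand (P Q : SProp) : SProp where
  carrier := {p | ∀ w' ≥ p.1, ∀ m' ≥ p.2, ∀ m'' c, Res.Comp m' m'' c →
    (w', m'') ∈ P → (w', c) ∈ Q}
  upper' := fun _ _ h hp w' hw' m' hm' => hp w' (h.1.trans hw') m' (h.2.trans hm')

def semPointsTo (l : ℕ) (v : CVal) : SProp where
  carrier := {p | p.2.heap.lookup l = some v}
  upper' := by
    rintro ⟨w, m⟩ ⟨w', m'⟩ ⟨_, x, hx⟩ h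
    have h' : m.heap.lookup l = some v := h
    change m'.heap.lookup l = some v
    rw [hx.heap, Finmap.lookup_union_left (Finmap.mem_of_lookup_eq_some h'), h']

def semSpec (S : SSpec) : SProp where
  carrier := {p | p.1 ∈ S}
  upper' := fun _ _ h hp => S.upper h.1 hp

def semValid (P : SProp) : SSpec where
  carrier := {w | ∀ m : Res, (w, m) ∈ P}
  upper' := fun w _ h hw m => P.upper (a := (w, m)) ⟨h, le_rfl⟩ (hw m)

/-- Resources whose trace component lies above a given one. -/
def semTraceRes (τ : TraceRes) : SProp where
  carrier := {p | τ ≤ p.2.tr}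
  upper' := by
    rintro ⟨w, m⟩ ⟨w', m'⟩ ⟨_, x, hx⟩ h
    exact le_trans (b := m.tr) h ⟨x.tr, hx.tr⟩

def semInv (I : Trace → Bool) : SProp where
  carrier := {p | p.1.inv = {t | I t = true}}
  upper' := fun _ _ h hp => h.1.2.symm.trans hp

def semTriple (P : SProp) (e : CExp) (Q : CVal → SProp) : SSpec where
  carrier := {w | ∀ w' ≥ w, ∀ m : Res, (w', m) ∈ P → m ∈ wp Q e w'}
  upper' := fun _ _ h hw w' hw' => hw w' (h.trans hw')

/-- The interpretation of terms.  `fold` is the fold from the right, so that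
`fold(cons(x, xs), N₁, N₂) = N₂(fold(xs, N₁, N₂), x)`. -/
def Tm.denote : {Γ : List Ty} → {τ : Ty} → Tm Γ τ → Env Γ → τ.denote
  | _, _, .var x, ρ => ρ _ x
  | _, _, .lam M, ρ => fun a => M.denote (Env.cons a ρ)
  | _, _, .app M N, ρ => (M.denote ρ) (N.denote ρ)
  | _, _, .unit, _ => ()
  | _, _, .pair M N, ρ => (M.denote ρ, N.denote ρ)
  | _, _, .fst M, ρ => (M.denote ρ).1
  | _, _, .snd M, ρ => (M.denote ρ).2
  | _, _, .bot, _ => semPure False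
  | _, _, .top, _ => semPure True
  | _, _, .or P Q, ρ => semOr (P.denote ρ) (Q.denote ρ)
  | _, _, .and P Q, ρ => semAnd (P.denote ρ) (Q.denote ρ)
  | _, _, .imp P Q, ρ => semImp (P.denote ρ) (Q.denote ρ)
  | _, _, .all τ P, ρ => semAll fun a : τ.denote => P.denote (Env.cons a ρ)
  | _, _, .ex τ P, ρ => semEx fun a : τ.denote => P.denote (Env.cons a ρ)
  | _, _, .eq M N, ρ => semPure (M.denote ρ = N.denote ρ)
  | _, _, .tt, _ => true
  | _, _, .ff, _ => false
  | _, _, .cond M N₁ N₂, ρ => bif (M.denote ρ : Bool) then N₁.denote ρ else N₂.denote ρ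
  | _, _, .valid P, ρ => semValid (P.denote ρ)
  | _, _, .emp, _ => semPure (α := World × Res) True
  | _, _, .star P Q, ρ => semStar (P.denote ρ) (Q.denote ρ)
  | _, _, .wand P Q, ρ => semWand (P.denote ρ) (Q.denote ρ)
  | _, _, .pointsTo M N, ρ => semPointsTo (M.denote ρ) (N.denote ρ)
  | _, _, .triple P e Q, ρ => semTriple (P.denote ρ) (e.denote ρ) (Q.denote ρ)
  | _, _, .spec S, ρ => semSpec (S.denote ρ)
  | _, _, .nil, _ => []
  | _, _, .cons M N, ρ => (M.denote ρ) :: (N.denote ρ)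
  | _, _, .fold M N₁ N₂, ρ =>
      List.foldr (fun x acc => (N₂.denote ρ) (acc, x)) (N₁.denote ρ) (M.denote ρ)
  | _, _, .trace M, ρ => semTraceRes (.own (M.denote ρ))
  | _, _, .hist M, ρ => semTraceRes (.hist (M.denote ρ))
  | _, _, .inv M, ρ => semInv (M.denote ρ)
  | _, _, .ofLoc M, ρ => Val.atom (Atom.loc (M.denote ρ))
  | _, _, .val v σ, ρ => v.subst fun i => (σ i).denote ρ
  | _, _, .exp e σ τ, ρ => e.subst (fun i => (σ i).denote ρ) fun j => (τ j).denote ρ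

/-! ## The logic -/

/-- Conclusions of judgements: `Γ ∣ Θ ⊢ S` for a specification `S`, or `Γ ∣ Θ ∣ P ⊢ Q` for resource
assertions `P` and `Q`. -/
inductive Concl (Γ : List Ty) : Type
  | holds (S : Tm Γ .spec) : Concl Γ
  | entails (P Q : Tm Γ .prop) : Concl Γ

def Concl.subst {Γ Δ : List Ty} (θ : Sub Γ Δ) : Concl Γ → Concl Δ
  | .holds S => .holds (S.subst θ)
  | .entails P Q => .entails (P.subst θ) (Q.subst θ)

def Concl.wk {Γ : List Ty} {σ : Ty} : Concl Γ → Concl (σ :: Γ)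
  | .holds S => .holds S.wk
  | .entails P Q => .entails P.wk Q.wk

abbrev Ctx.wk {Γ : List Ty} {σ : Ty} (Θ : List (Tm Γ .spec)) : List (Tm (σ :: Γ) .spec) :=
  Θ.map Tm.wk

open Concl in
/-- Derivability of judgements, with specification context `Θ`: the usual rules of intuitionistic
higher-order logic (for specifications) and of intuitionistic higher-order separation logic (for
assertions), the rules for the trace assertions, and the rules for Hoare triples. -/
inductive Derivable : (Γ : List Ty) → List (Tm Γ .spec) → Concl Γ → Prop
  -- structural rules, for both forms of judgement
  | hyp {Γ Θ S} (h : S ∈ Θ) : Derivable Γ Θ (holds S)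
  | cut {Γ Θ S J} (h₁ : Derivable Γ Θ (holds S)) (h₂ : Derivable Γ (S :: Θ) J) : Derivable Γ Θ J
  | weaken {Γ Θ Θ' J} (h : Θ ⊆ Θ') (h₁ : Derivable Γ Θ J) : Derivable Γ Θ' J
  | subst {Γ Δ Θ J} (θ : Sub Γ Δ) (h : Derivable Γ Θ J) :
      Derivable Δ (Θ.map fun S => S.subst θ) (J.subst θ)
  -- specification logic: intuitionistic higher-order logic
  | topI {Γ Θ} : Derivable Γ Θ (holds .top)
  | botE {Γ Θ J} (h : Derivable Γ Θ (holds .bot)) : Derivable Γ Θ J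
  | andI {Γ Θ S T} (h₁ : Derivable Γ Θ (holds S)) (h₂ : Derivable Γ Θ (holds T)) :
      Derivable Γ Θ (holds (.and S T))
  | andE₁ {Γ Θ S T} (h : Derivable Γ Θ (holds (.and S T))) : Derivable Γ Θ (holds S)
  | andE₂ {Γ Θ S T} (h : Derivable Γ Θ (holds (.and S T))) : Derivable Γ Θ (holds T)
  | orI₁ {Γ Θ S T} (h : Derivable Γ Θ (holds S)) : Derivable Γ Θ (holds (.or S T))
  | orI₂ {Γ Θ S T} (h : Derivable Γ Θ (holds T)) : Derivable Γ Θ (holds (.or S T))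
  | orE {Γ Θ S T J} (h : Derivable Γ Θ (holds (.or S T))) (h₁ : Derivable Γ (S :: Θ) J)
      (h₂ : Derivable Γ (T :: Θ) J) : Derivable Γ Θ J
  | impI {Γ Θ S T} (h : Derivable Γ (S :: Θ) (holds T)) : Derivable Γ Θ (holds (.imp S T))
  | impE {Γ Θ S T} (h₁ : Derivable Γ Θ (holds (.imp S T))) (h₂ : Derivable Γ Θ (holds S)) :
      Derivable Γ Θ (holds T)
  | allI {Γ Θ τ S} (h : Derivable (τ :: Γ) (Ctx.wk Θ) (holds S)) :
      Derivable Γ Θ (holds (.all τ S))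
  | allE {Γ Θ τ S} (M : Tm Γ τ) (h : Derivable Γ Θ (holds (.all τ S))) :
      Derivable Γ Θ (holds (S.inst M))
  | exI {Γ Θ τ} {S : Tm (τ :: Γ) .spec} (M : Tm Γ τ) (h : Derivable Γ Θ (holds (S.inst M))) :
      Derivable Γ Θ (holds (.ex τ S))
  | exE {Γ Θ τ S J} (h : Derivable Γ Θ (holds (.ex τ S)))
      (h₁ : Derivable (τ :: Γ) (S :: Ctx.wk Θ) J.wk) : Derivable Γ Θ J
  -- equality
  | eqRefl {Γ Θ τ} (M : Tm Γ τ) : Derivable Γ Θ (holds (.eq M M))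
  | eqSubst {Γ Θ τ} {M N : Tm Γ τ} (J : Concl (τ :: Γ)) (h : Derivable Γ Θ (holds (.eq M N)))
      (h₁ : Derivable Γ Θ (J.subst (Sub.one M))) : Derivable Γ Θ (J.subst (Sub.one N))
  | funExt {Γ Θ σ τ} {M N : Tm Γ (.fn σ τ)}
      (h : Derivable (σ :: Γ) (Ctx.wk Θ) (holds (.eq (.app M.wk v₀) (.app N.wk v₀)))) :
      Derivable Γ Θ (holds (.eq M N))
  | specExt {Γ Θ} {S T : Tm Γ .spec} (h₁ : Derivable Γ [S] (holds T))
      (h₂ : Derivable Γ [T] (holds S)) : Derivable Γ Θ (holds (.eq S T))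
  | propExt {Γ Θ} {P Q : Tm Γ .prop} (h₁ : Derivable Γ [] (entails P Q))
      (h₂ : Derivable Γ [] (entails Q P)) : Derivable Γ Θ (holds (.eq P Q))
  -- the term language
  | beta {Γ Θ σ τ} (M : Tm (σ :: Γ) τ) (N : Tm Γ σ) :
      Derivable Γ Θ (holds (.eq (.app (.lam M) N) (M.inst N)))
  | unitEta {Γ Θ} (M : Tm Γ .unit) : Derivable Γ Θ (holds (.eq M .unit))
  | fstPair {Γ Θ σ τ} (M : Tm Γ σ) (N : Tm Γ τ) :
      Derivable Γ Θ (holds (.eq (.fst (.pair M N)) M))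
  | sndPair {Γ Θ σ τ} (M : Tm Γ σ) (N : Tm Γ τ) :
      Derivable Γ Θ (holds (.eq (.snd (.pair M N)) N))
  | pairEta {Γ Θ σ τ} (M : Tm Γ (.prod σ τ)) :
      Derivable Γ Θ (holds (.eq M (.pair (.fst M) (.snd M))))
  | condTrue {Γ Θ τ} (M N : Tm Γ τ) : Derivable Γ Θ (holds (.eq (.cond .tt M N) M))
  | condFalse {Γ Θ τ} (M N : Tm Γ τ) : Derivable Γ Θ (holds (.eq (.cond .ff M N) N))
  | boolNe {Γ Θ} (h : Derivable Γ Θ (holds (.eq .tt .ff))) : Derivable Γ Θ (holds .bot)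
  | boolCases {Γ Θ} (S : Tm (.bool :: Γ) .spec) (M : Tm Γ .bool)
      (h₁ : Derivable Γ Θ (holds (S.inst .tt))) (h₂ : Derivable Γ Θ (holds (S.inst .ff))) :
      Derivable Γ Θ (holds (S.inst M))
  | foldNil {Γ Θ σ τ} (N₁ : Tm Γ σ) (N₂ : Tm Γ (.fn (.prod σ τ) σ)) :
      Derivable Γ Θ (holds (.eq (.fold .nil N₁ N₂) N₁))
  | foldCons {Γ Θ σ τ} (M : Tm Γ τ) (N : Tm Γ (.seq τ)) (N₁ : Tm Γ σ)
      (N₂ : Tm Γ (.fn (.prod σ τ) σ)) :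
      Derivable Γ Θ (holds (.eq (.fold (.cons M N) N₁ N₂) (.app N₂ (.pair (.fold N N₁ N₂) M))))
  | consNe {Γ Θ τ} {M : Tm Γ τ} {N : Tm Γ (.seq τ)}
      (h : Derivable Γ Θ (holds (.eq .nil (.cons M N)))) : Derivable Γ Θ (holds .bot)
  | consInj₁ {Γ Θ τ} {M M' : Tm Γ τ} {N N' : Tm Γ (.seq τ)}
      (h : Derivable Γ Θ (holds (.eq (.cons M N) (.cons M' N')))) : Derivable Γ Θ (holds (.eq M M'))
  | consInj₂ {Γ Θ τ} {M M' : Tm Γ τ} {N N' : Tm Γ (.seq τ)}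
      (h : Derivable Γ Θ (holds (.eq (.cons M N) (.cons M' N')))) : Derivable Γ Θ (holds (.eq N N'))
  | seqInd {Γ Θ τ} (S : Tm (.seq τ :: Γ) .spec) (M : Tm Γ (.seq τ))
      (h₁ : Derivable Γ Θ (holds (S.inst .nil)))
      (h₂ : Derivable (τ :: .seq τ :: Γ) (S.wk :: Ctx.wk (Ctx.wk Θ))
        (holds (S.wk₁.wk₁.inst (.cons v₀ v₁)))) :
      Derivable Γ Θ (holds (S.inst M))
  -- program values and expressions as terms
  | valVar {Γ Θ n} (i : Fin n) (σ : Fin n → Tm Γ .val) :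
      Derivable Γ Θ (holds (.eq (.val (.atom (.var i)) σ) (σ i)))
  | valSubst {Γ Θ n m} (v : Val n) (δ : Fin n → Val m) (σ : Fin m → Tm Γ .val) :
      Derivable Γ Θ (holds (.eq (.val (v.subst δ) σ) (.val v fun i => .val (δ i) σ)))
  | expVar {Γ Θ k n} (j : Fin k) (σ : Fin n → Tm Γ .val) (τ : Fin k → Tm Γ .exp) :
      Derivable Γ Θ (holds (.eq (.exp (.evar j) σ τ) (τ j)))
  | expSubst {Γ Θ k k' n m} (e : Exp k n) (δ : Fin n → Val m) (ε : Fin k → Exp k' m)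
      (σ : Fin m → Tm Γ .val) (τ : Fin k' → Tm Γ .exp) :
      Derivable Γ Θ (holds (.eq (.exp (e.subst δ ε) σ τ)
        (.exp e (fun i => .val (δ i) σ) fun j => .exp (ε j) σ τ)))
  | constNe {Γ Θ} {u v : CVal} (huv : u ≠ v)
      (h : Derivable Γ Θ (holds (.eq (.const u) (.const v)))) : Derivable Γ Θ (holds .bot)
  | pairInj {Γ Θ} (i : Fin 2) {U V : Fin 2 → Tm Γ .val}
      (h : Derivable Γ Θ (holds (.eq (.val (.pair (.atom (.var 0)) (.atom (.var 1))) U)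
        (.val (.pair (.atom (.var 0)) (.atom (.var 1))) V)))) :
      Derivable Γ Θ (holds (.eq (U i) (V i)))
  | pairNe {Γ Θ} {U : Fin 2 → Tm Γ .val} {a : Atom 0}
      (h : Derivable Γ Θ (holds (.eq (.val (.pair (.atom (.var 0)) (.atom (.var 1))) U)
        (.const (.atom a))))) :
      Derivable Γ Θ (holds .bot)
  | locInj {Γ Θ} {M N : Tm Γ .loc} (h : Derivable Γ Θ (holds (.eq (.ofLoc M) (.ofLoc N)))) :
      Derivable Γ Θ (holds (.eq M N))
  -- assertion logic: intuitionistic higher-order logic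
  | aId {Γ Θ} (P : Tm Γ .prop) : Derivable Γ Θ (entails P P)
  | aTrans {Γ Θ P Q R} (h₁ : Derivable Γ Θ (entails P Q)) (h₂ : Derivable Γ Θ (entails Q R)) :
      Derivable Γ Θ (entails P R)
  | aTop {Γ Θ} (P : Tm Γ .prop) : Derivable Γ Θ (entails P .top)
  | aBot {Γ Θ} (P : Tm Γ .prop) : Derivable Γ Θ (entails .bot P)
  | aAndI {Γ Θ P Q R} (h₁ : Derivable Γ Θ (entails P Q)) (h₂ : Derivable Γ Θ (entails P R)) :
      Derivable Γ Θ (entails P (.and Q R))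
  | aAndE₁ {Γ Θ} (P Q : Tm Γ .prop) : Derivable Γ Θ (entails (.and P Q) P)
  | aAndE₂ {Γ Θ} (P Q : Tm Γ .prop) : Derivable Γ Θ (entails (.and P Q) Q)
  | aOrI₁ {Γ Θ} (P Q : Tm Γ .prop) : Derivable Γ Θ (entails P (.or P Q))
  | aOrI₂ {Γ Θ} (P Q : Tm Γ .prop) : Derivable Γ Θ (entails Q (.or P Q))
  | aOrE {Γ Θ P Q R} (h₁ : Derivable Γ Θ (entails P R)) (h₂ : Derivable Γ Θ (entails Q R)) :
      Derivable Γ Θ (entails (.or P Q) R)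
  | aImpI {Γ Θ P Q R} (h : Derivable Γ Θ (entails (.and P Q) R)) :
      Derivable Γ Θ (entails P (.imp Q R))
  | aImpE {Γ Θ P Q R} (h : Derivable Γ Θ (entails P (.imp Q R))) :
      Derivable Γ Θ (entails (.and P Q) R)
  | aAllI {Γ Θ τ P Q} (h : Derivable (τ :: Γ) (Ctx.wk Θ) (entails (Tm.wk P) Q)) :
      Derivable Γ Θ (entails P (.all τ Q))
  | aAllE {Γ Θ τ} (Q : Tm (τ :: Γ) .prop) (M : Tm Γ τ) :
      Derivable Γ Θ (entails (.all τ Q) (Q.inst M))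
  | aExI {Γ Θ τ} (Q : Tm (τ :: Γ) .prop) (M : Tm Γ τ) :
      Derivable Γ Θ (entails (Q.inst M) (.ex τ Q))
  | aExE {Γ Θ τ P Q} (h : Derivable (τ :: Γ) (Ctx.wk Θ) (entails P (Tm.wk Q))) :
      Derivable Γ Θ (entails (.ex τ P) Q)
  | aEqRefl {Γ Θ τ} (P : Tm Γ .prop) (M : Tm Γ τ) : Derivable Γ Θ (entails P (.eq M M))
  | aEqSubst {Γ Θ τ} {P : Tm Γ .prop} {M N : Tm Γ τ} (Q : Tm (τ :: Γ) .prop)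
      (h : Derivable Γ Θ (entails P (.eq M N))) (h₁ : Derivable Γ Θ (entails P (Q.inst M))) :
      Derivable Γ Θ (entails P (Q.inst N))
  -- assertion logic: separation logic
  | starMono {Γ Θ P P' Q Q'} (h₁ : Derivable Γ Θ (entails P P'))
      (h₂ : Derivable Γ Θ (entails Q Q')) : Derivable Γ Θ (entails (.star P Q) (.star P' Q'))
  | starComm {Γ Θ} (P Q : Tm Γ .prop) : Derivable Γ Θ (entails (.star P Q) (.star Q P))
  | starAssoc {Γ Θ} (P Q R : Tm Γ .prop) :
      Derivable Γ Θ (entails (.star (.star P Q) R) (.star P (.star Q R)))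
  | starEmpI {Γ Θ} (P : Tm Γ .prop) : Derivable Γ Θ (entails P (.star P .emp))
  | starEmpE {Γ Θ} (P : Tm Γ .prop) : Derivable Γ Θ (entails (.star P .emp) P)
  | empI {Γ Θ} (P : Tm Γ .prop) : Derivable Γ Θ (entails P .emp)
  | wandI {Γ Θ P Q R} (h : Derivable Γ Θ (entails (.star P Q) R)) :
      Derivable Γ Θ (entails P (.wand Q R))
  | wandE {Γ Θ P Q R} (h : Derivable Γ Θ (entails P (.wand Q R))) :
      Derivable Γ Θ (entails (.star P Q) R)
  | pointsToExcl {Γ Θ} (M : Tm Γ .loc) (N N' : Tm Γ .val) :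
      Derivable Γ Θ (entails (.star (.pointsTo M N) (.pointsTo M N')) .bot)
  -- embeddings between the two logics
  | pSpec {Γ Θ} (P : Tm Γ .prop) (S : Tm Γ .spec) : Derivable Γ (S :: Θ) (entails P (.spec S))
  | pSpecE {Γ Θ P Q} {S : Tm Γ .spec} (h : Derivable Γ (S :: Θ) (entails P Q)) :
      Derivable Γ Θ (entails (.and P (.spec S)) Q)
  | pValid {Γ Θ} (P Q : Tm Γ .prop) : Derivable Γ (.valid Q :: Θ) (entails P Q)
  | valid {Γ Θ P} (h : Derivable Γ Θ (entails .emp P)) : Derivable Γ Θ (holds (.valid P))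
  -- trace assertions
  | traceExcl {Γ Θ} (t₁ t₂ : Tm Γ .trace) :
      Derivable Γ Θ (entails (.star (.trace t₁) (.trace t₂)) .bot)
  | pInvDupl {Γ Θ} (I : Tm Γ (.fn .trace .bool)) :
      Derivable Γ Θ (entails (.inv I) (.star (.inv I) (.inv I)))
  | pHistDupl {Γ Θ} (t : Tm Γ .trace) :
      Derivable Γ Θ (entails (.hist t) (.star (.hist t) (.hist t)))
  | pAllocHist {Γ Θ} (t : Tm Γ .trace) :
      Derivable Γ Θ (entails (.trace t) (.star (.trace t) (.hist t)))
  | pUseHist {Γ Θ} (t₁ t₂ : Tm Γ .trace) :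
      Derivable Γ Θ (entails (.star (.trace t₁) (.hist t₂)) (.star (.trace t₁) (t₂.pref t₁)))
  -- Hoare triples: structural rules
  | specOut {Γ Θ S P e R} (h : Derivable Γ (S :: Θ) (holds (.triple P e R))) :
      Derivable Γ Θ (holds (.triple (.star P (.spec S)) e R))
  | frame {Γ Θ P e Q} (R : Tm Γ .prop) (h : Derivable Γ Θ (holds (.triple P e Q))) :
      Derivable Γ Θ (holds (.triple (.star P R) e (.lam (.star (.app Q.wk v₀) R.wk))))
  | csq {Γ Θ} {P₁ P₂ : Tm Γ .prop} {e} {Q₁ Q₂ : Tm Γ (.fn .val .prop)}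
      (h₁ : Derivable Γ Θ (entails P₁ P₂)) (h₂ : Derivable Γ Θ (holds (.triple P₂ e Q₂)))
      (h₃ : Derivable (.val :: Γ) (Ctx.wk Θ) (entails (.app Q₂.wk v₀) (.app Q₁.wk v₀))) :
      Derivable Γ Θ (holds (.triple P₁ e Q₁))
  | exPre {Γ Θ τ P e Q}
      (h : Derivable (τ :: Γ) (Ctx.wk Θ) (holds (.triple P (Tm.wk e) (Tm.wk Q)))) :
      Derivable Γ Θ (holds (.triple (.ex τ P) e Q))
  | bind {Γ Θ k n} (K : ECtx k n) (e : Exp k n) (σ : Fin n → Tm Γ .val) (τ : Fin k → Tm Γ .exp)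
      (P : Tm Γ .prop) (Q : Tm (.val :: Γ) .prop) (R : Tm (.val :: Γ) (.fn .val .prop))
      (h₁ : Derivable Γ Θ (holds (.triple P (.exp e σ τ) (.lam Q))))
      (h₂ : Derivable (.val :: Γ) (Ctx.wk Θ) (holds (.triple Q
        (.exp ((K.rename Fin.succ).fill (.atom (.var 0)))
          (Fin.cons v₀ fun i => (σ i).wk) fun j => (τ j).wk) R))) :
      Derivable Γ Θ (holds (.triple P (.exp (K.fill e) σ τ)
        (.lam (.ex .val (.app R.wk₁ v₁)))))
  -- Hoare triples: language constructs
  | ret {Γ Θ} (V : Tm Γ .val) : Derivable Γ Θ (holds (.triple .top V.ret (.lam (.eq v₀ V.wk))))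
  | abs {Γ Θ k n} (e : Exp k (n + 1)) (σ : Fin n → Tm Γ .val) (τ : Fin k → Tm Γ .exp)
      (P : Tm (.val :: Γ) .prop) (Q : Tm (.val :: Γ) (.fn .val .prop))
      (h : Derivable (.val :: Γ) (Ctx.wk Θ) (holds (.triple P
        (.exp e (Fin.cons v₀ fun i => (σ i).wk) fun j => (τ j).wk) Q))) :
      Derivable Γ Θ (holds (.triple .emp (.exp (.lam e) σ τ)
        (.lam (.all .val (.spec (.triple P.wk₁
          (.exp (k := 0) (n := 2) (.app (.atom (.var 0)) (.atom (.var 1))) ![v₁, v₀] Fin.elim0)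
          Q.wk₁))))))
  | proj {Γ Θ} (i : Fin 2) (V : Fin 2 → Tm Γ .val) :
      Derivable Γ Θ (holds (.triple .emp
        (.exp (k := 0) (.proj i (.pair (.atom (.var 0)) (.atom (.var 1)))) V Fin.elim0)
        (.lam (.eq v₀ (V i).wk))))
  | itePos {Γ Θ k n} (z : ℤ) (hz : 0 < z) (e₁ e₂ : Exp k n) (σ : Fin n → Tm Γ .val)
      (τ : Fin k → Tm Γ .exp) (P : Tm Γ .prop) (Q : Tm Γ (.fn .val .prop))
      (h : Derivable Γ Θ (holds (.triple P (.exp e₁ σ τ) Q))) :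
      Derivable Γ Θ (holds (.triple P (.exp (.ite (.atom (.int z)) e₁ e₂) σ τ) Q))
  | iteZero {Γ Θ k n} (e₁ e₂ : Exp k n) (σ : Fin n → Tm Γ .val)
      (τ : Fin k → Tm Γ .exp) (P : Tm Γ .prop) (Q : Tm Γ (.fn .val .prop))
      (h : Derivable Γ Θ (holds (.triple P (.exp e₂ σ τ) Q))) :
      Derivable Γ Θ (holds (.triple P (.exp (.ite (.atom (.int 0)) e₁ e₂) σ τ) Q))
  | alloc {Γ Θ} (V : Tm Γ .val) :
      Derivable Γ Θ (holds (.triple .emp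
        (.exp (k := 0) (n := 1) (.ref (.atom (.var 0))) ![V] Fin.elim0)
        (.lam (.ex .loc (.star (.eq v₁ (.ofLoc v₀)) (.pointsTo v₀ V.wk.wk))))))
  | read {Γ Θ} (L : Tm Γ .loc) (V : Tm Γ .val) :
      Derivable Γ Θ (holds (.triple (.pointsTo L V)
        (.exp (k := 0) (n := 1) (.deref (.atom (.var 0))) ![.ofLoc L] Fin.elim0)
        (.lam (.star (.pointsTo L.wk V.wk) (.eq v₀ V.wk)))))
  | write {Γ Θ} (L : Tm Γ .loc) (V : Tm Γ .val) :
      Derivable Γ Θ (holds (.triple (.ex .val (.pointsTo L.wk v₀))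
        (.exp (k := 0) (n := 2) (.op .assign (.atom (.var 0)) (.atom (.var 1))) ![.ofLoc L, V]
          Fin.elim0)
        (.lam (.star (.pointsTo L.wk V.wk) (.eq v₀ (.const (.atom .unit)))))))
  | opEq {Γ Θ} (U V : Tm Γ .val) :
      Derivable Γ Θ (holds (.triple .emp
        (.exp (k := 0) (n := 2) (.op .eq (.atom (.var 0)) (.atom (.var 1))) ![U, V] Fin.elim0)
        (.lam (.or
          (.and (.eq U.wk V.wk) (.eq v₀ (.const (.atom (.int 1)))))
          (.and (.imp (.eq U.wk V.wk) .bot) (.eq v₀ (.const (.atom (.int 0)))))))))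
  | opAdd {Γ Θ} (a b : ℤ) :
      Derivable Γ Θ (holds (.triple .emp
        (.exp (k := 0) (n := 0) (.op .add (.atom (.int a)) (.atom (.int b))) Fin.elim0 Fin.elim0)
        (.lam (.eq v₀ (.const (.atom (.int (a + b))))))))
  | opSub {Γ Θ} (a b : ℤ) :
      Derivable Γ Θ (holds (.triple .emp
        (.exp (k := 0) (n := 0) (.op .sub (.atom (.int a)) (.atom (.int b))) Fin.elim0 Fin.elim0)
        (.lam (.eq v₀ (.const (.atom (.int (a - b))))))))
  | opMul {Γ Θ} (a b : ℤ) :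
      Derivable Γ Θ (holds (.triple .emp
        (.exp (k := 0) (n := 0) (.op .mul (.atom (.int a)) (.atom (.int b))) Fin.elim0 Fin.elim0)
        (.lam (.eq v₀ (.const (.atom (.int (a * b))))))))
  | emit {Γ Θ} (t : Tm Γ .trace) (V : Tm Γ .val) (I : Tm Γ (.fn .trace .bool))
      (h : Derivable Γ Θ (holds (.eq (.app I (t.snoc V)) .tt))) :
      Derivable Γ Θ (holds (.triple (.star (.trace t) (.inv I))
        (.exp (k := 0) (n := 1) (.emit (.atom (.var 0))) ![V] Fin.elim0)
        (.lam (.star (.trace (t.wk.snoc V.wk)) (.eq v₀ (.const (.atom .unit)))))))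

end TraceLogic

open TraceLogic

/-! The theorem is soundness of the logic followed by adequacy of `wp`. Soundness
(`Derivable.sound`) says that a derivable judgement holds under every environment, at every world
that satisfies its specification context. For a triple with empty context this gives `m ∈ wp Q e w`.

Adequacy (`wp_adequacy`) is an induction on the reduction sequence. Each step unfolds the greatest
fixed point once and yields a later world and a new resource that still erases to the current trace
and state; at an irreducible configuration the first clause of `wpStep` supplies the value and the
postcondition. The erasure relation contains `t ∈ w.inv`, and passing to a later world never changes
the invariant, so the final trace lies in the invariant of the initial world.

The content of soundness is in the triples. Since `wpStep` quantifies over every frame `r`, framing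
amounts to reassociating products; since `wp` is a greatest fixed point, framing and sequencing are
proved by coinduction (`wp_coind`, `wp_frame_mono`, `wp_bind`). Sequencing also needs that a redex
inside `K[e]`, with `e` not a value, lies in `e` (`ECtx.decompose`).

The constructs that affect the world or the trace are `λ` and `emit`. Abstraction extends the
function environment by a fresh name, and the stored body persists in all later worlds. For `emit`,
ownership of the trace determines the actual trace, and every frame holds only a prefix of it, so
the trace can be extended without disturbing the frame. -/

namespace TraceLogic

/-! ## Substitution in programs -/

theorem Val.subst_subst {n m p : ℕ} (v : Val n) (δ : Fin n → Val m) (σ : Fin m → Val p) :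
    (v.subst δ).subst σ = v.subst fun i => (δ i).subst σ := by
  induction v with
  | atom a => cases a <;> rfl
  | pair u v hu hv => simp only [Val.subst, hu, hv]

theorem Val.rename_subst {n m p : ℕ} (v : Val n) (ξ : Fin n → Fin m) (σ : Fin m → Val p) :
    (v.rename ξ).subst σ = v.subst fun i => σ (ξ i) :=
  v.subst_subst _ _

theorem Val.subst_rename {n m p : ℕ} (v : Val n) (σ : Fin n → Val m) (ξ : Fin m → Fin p) :
    (v.subst σ).rename ξ = v.subst fun i => (σ i).rename ξ :=
  v.subst_subst _ _

theorem Val.subst_var {n : ℕ} (v : Val n) : (v.subst fun i => .atom (.var i)) = v := by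
  induction v with
  | atom a => cases a <;> rfl
  | pair u v hu hv => simp only [Val.subst, hu, hv]

theorem Val.subst_closed (v : CVal) (σ : Fin 0 → CVal) : v.subst σ = v := by
  rw [Subsingleton.elim σ fun i => .atom (.var i), v.subst_var]

theorem Val.toExp_subst {k k' n m : ℕ} (v : Val n) (σ : Fin n → Val m) (τ : Fin k → Exp k' m) :
    v.toExp.subst σ τ = (v.subst σ).toExp := by
  induction v with
  | atom a => rfl
  | pair u v hu hv => simp only [Val.toExp, Val.subst, Exp.subst, hu, hv]

theorem Val.toExp_rename {k n m : ℕ} (v : Val n) (ξ : Fin n → Fin m) :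
    (v.toExp : Exp k n).rename ξ = (v.rename ξ).toExp := by
  induction v with
  | atom a => rfl
  | pair u v hu hv => simp only [Val.toExp, Val.rename, Val.subst, Exp.rename] at *; simp [hu, hv]

/-- Recovers the value operands when a reduction of a redex built from `v.toExp` is inverted. -/
theorem Val.toExp_injective {k n : ℕ} : Function.Injective (Val.toExp : Val n → Exp k n) := by
  intro u
  induction u with
  | atom a => intro v h; cases v <;> simp_all [Val.toExp]
  | pair u u' hu hu' =>
    intro v h
    cases v with
    | atom b => simp [Val.toExp] at h
    | pair v v' =>
      simp only [Val.toExp, Exp.pair.injEq] at h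
      rw [hu h.1, hu' h.2]

theorem liftRen_comp {n m p : ℕ} (ξ : Fin n → Fin m) (ζ : Fin m → Fin p) :
    (fun i => liftRen ζ (liftRen ξ i)) = liftRen fun i => ζ (ξ i) := by
  funext i; refine Fin.cases ?_ (fun i => ?_) i <;> simp [liftRen]

theorem liftSub_liftRen {n m p : ℕ} (ξ : Fin n → Fin m) (σ : Fin m → Val p) :
    (fun i => liftSub σ (liftRen ξ i)) = liftSub fun i => σ (ξ i) := by
  funext i; refine Fin.cases ?_ (fun i => ?_) i <;> simp [liftRen, liftSub]

theorem liftSub_rename {n m p : ℕ} (σ : Fin n → Val m) (ξ : Fin m → Fin p) :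
    (fun i => (liftSub σ i).rename (liftRen ξ)) = liftSub fun i => (σ i).rename ξ := by
  funext i
  refine Fin.cases ?_ (fun i => ?_) i
  · simp [liftSub, Val.rename, Val.subst, Atom.subst, liftRen]
  · simp only [liftSub, Fin.cons_succ]
    simp [Val.rename, Val.subst_subst, Val.subst, Atom.subst, liftRen]

theorem liftSub_subst {n m p : ℕ} (δ : Fin n → Val m) (σ : Fin m → Val p) :
    (fun i => (liftSub δ i).subst (liftSub σ)) = liftSub fun i => (δ i).subst σ := by
  funext i
  refine Fin.cases ?_ (fun i => ?_) i
  · simp [liftSub, Val.subst, Atom.subst]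
  · simp only [liftSub, Fin.cons_succ, Val.rename_subst, Val.subst_rename]

theorem liftSub_var {n : ℕ} :
    (liftSub fun i : Fin n => Val.atom (.var i)) = fun i => .atom (.var i) := by
  funext i
  refine Fin.cases ?_ (fun i => ?_) i <;> simp [liftSub, Val.rename, Val.subst, Atom.subst]

/-- Expression variables are weakened under binders, which fixes the order of the composition laws:
the `λ` case of `Exp.subst_rename` needs this one, and that of `Exp.subst_subst` needs both mixed
laws. -/
theorem Exp.rename_rename {k n m p : ℕ} (e : Exp k n) (ξ : Fin n → Fin m) (ζ : Fin m → Fin p) :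
    (e.rename ξ).rename ζ = e.rename fun i => ζ (ξ i) := by
  induction e generalizing m p with
  | atom a => cases a <;> rfl
  | evar j => rfl
  | lam e ih => simp only [Exp.rename, ih, liftRen_comp]
  | emit v => simp only [Exp.rename, Val.rename, Val.subst_subst]; rfl
  | _ => simp only [Exp.rename, *]

theorem Exp.rename_subst {k k' n m p : ℕ} (e : Exp k n) (ξ : Fin n → Fin m) (σ : Fin m → Val p)
    (τ : Fin k → Exp k' p) : (e.rename ξ).subst σ τ = e.subst (fun i => σ (ξ i)) τ := by
  induction e generalizing m p with
  | atom a => cases a <;> rfl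
  | evar j => rfl
  | lam e ih => simp only [Exp.rename, Exp.subst, ih, liftSub_liftRen]
  | emit v => simp only [Exp.rename, Exp.subst, Val.rename_subst]
  | _ => simp only [Exp.rename, Exp.subst, *]

theorem Exp.subst_rename {k k' n m p : ℕ} (e : Exp k n) (σ : Fin n → Val m) (τ : Fin k → Exp k' m)
    (ξ : Fin m → Fin p) :
    (e.subst σ τ).rename ξ = e.subst (fun i => (σ i).rename ξ) fun j => (τ j).rename ξ := by
  induction e generalizing m p with
  | atom a => simp only [Exp.subst, Val.toExp_rename]; cases a <;> rfl
  | evar j => rfl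
  | lam e ih =>
    simp only [Exp.rename, Exp.subst, ih, liftSub_rename, Exp.rename_rename]
    simp [liftRen]
  | emit v => simp only [Exp.rename, Exp.subst, Val.subst_rename]
  | _ => simp only [Exp.rename, Exp.subst, *]

theorem Exp.subst_subst {k k' k'' n m p : ℕ} (e : Exp k n) (δ : Fin n → Val m)
    (ε : Fin k → Exp k' m) (σ : Fin m → Val p) (τ : Fin k' → Exp k'' p) :
    (e.subst δ ε).subst σ τ = e.subst (fun i => (δ i).subst σ) fun j => (ε j).subst σ τ := by
  induction e generalizing m p with
  | atom a => simp only [Exp.subst, Val.toExp_subst]; cases a <;> rfl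
  | evar j => rfl
  | lam e ih =>
    simp only [Exp.subst, ih, liftSub_subst, Exp.rename_subst, Exp.subst_rename]
    simp [liftSub]
  | emit v => simp only [Exp.subst, Val.subst_subst]
  | _ => simp only [Exp.subst, *]

theorem Exp.subst_var {n : ℕ} (e : Exp 0 n) (τ : Fin 0 → Exp 0 n) :
    e.subst (fun i => .atom (.var i)) τ = e := by
  induction e with
  | atom a => cases a <;> rfl
  | evar j => exact j.elim0
  | lam e ih => simp only [Exp.subst, liftSub_var, ih]
  | emit v => simp only [Exp.subst, Val.subst_var]
  | _ => simp only [Exp.subst, *]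

theorem Exp.subst_closed (e : CExp) (σ : Fin 0 → CVal) (τ : Fin 0 → CExp) : e.subst σ τ = e := by
  rw [Subsingleton.elim σ fun i => .atom (.var i), e.subst_var]

/-- Connects a `β`-step with the semantics of terms: the body stored for a closed `λ`-abstraction,
applied to `v`, is the original body under the environment extended by `v`. -/
theorem Exp.inst_subst_liftSub {k n : ℕ} (e : Exp k (n + 1)) (σ : Fin n → CVal)
    (τ : Fin k → CExp) (v : CVal) :
    (e.subst (liftSub σ) fun j => (τ j).rename Fin.succ).inst v = e.subst (Fin.cons v σ) τ := by
  rw [Exp.inst, Exp.subst_subst]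
  congr 1
  · funext i
    refine Fin.cases ?_ (fun i => ?_) i
    · simp [liftSub, Val.subst, Atom.subst]
    · simp only [liftSub, Fin.cons_succ, Val.rename_subst, Val.subst_closed]
  · funext j
    rw [Exp.rename_subst, Exp.subst_closed]

/-! ## Evaluation contexts -/

/-- Closes the context of the bind rule under an environment. Operands to the left of the hole are
kept as values, so the result is again an evaluation context. -/
def ECtx.subst {k k' n m : ℕ} (σ : Fin n → Val m) (τ : Fin k → Exp k' m) : ECtx k n → ECtx k' m
  | .hole => .hole
  | .appL K e => .appL (K.subst σ τ) (e.subst σ τ)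
  | .appR v K => .appR (v.subst σ) (K.subst σ τ)
  | .opL o K e => .opL o (K.subst σ τ) (e.subst σ τ)
  | .opR o v K => .opR o (v.subst σ) (K.subst σ τ)
  | .ite K e₁ e₂ => .ite (K.subst σ τ) (e₁.subst σ τ) (e₂.subst σ τ)
  | .pairL K e => .pairL (K.subst σ τ) (e.subst σ τ)
  | .pairR v K => .pairR (v.subst σ) (K.subst σ τ)
  | .proj i K => .proj i (K.subst σ τ)
  | .ref K => .ref (K.subst σ τ)
  | .deref K => .deref (K.subst σ τ)

theorem ECtx.fill_subst {k k' n m : ℕ} (K : ECtx k n) (e : Exp k n) (σ : Fin n → Val m)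
    (τ : Fin k → Exp k' m) : (K.fill e).subst σ τ = (K.subst σ τ).fill (e.subst σ τ) := by
  induction K <;> simp_all [ECtx.fill, ECtx.subst, Exp.subst, Val.toExp_subst]

theorem ECtx.rename_subst {k k' n m p : ℕ} (K : ECtx k n) (ξ : Fin n → Fin m) (σ : Fin m → Val p)
    (τ : Fin k → Exp k' p) : (K.rename ξ).subst σ τ = K.subst (fun i => σ (ξ i)) τ := by
  induction K <;> simp_all [ECtx.rename, ECtx.subst, Exp.rename_subst, Val.rename_subst]

/-- Composition of evaluation contexts. -/
def ECtx.comp {k n : ℕ} : ECtx k n → ECtx k n → ECtx k n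
  | .hole, K' => K'
  | .appL K e, K' => .appL (K.comp K') e
  | .appR v K, K' => .appR v (K.comp K')
  | .opL o K e, K' => .opL o (K.comp K') e
  | .opR o v K, K' => .opR o v (K.comp K')
  | .ite K e₁ e₂, K' => .ite (K.comp K') e₁ e₂
  | .pairL K e, K' => .pairL (K.comp K') e
  | .pairR v K, K' => .pairR v (K.comp K')
  | .proj i K, K' => .proj i (K.comp K')
  | .ref K, K' => .ref (K.comp K')
  | .deref K, K' => .deref (K.comp K')

theorem ECtx.fill_comp {k n : ℕ} (K K' : ECtx k n) (e : Exp k n) :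
    (K.comp K').fill e = K.fill (K'.fill e) := by
  induction K <;> simp_all [ECtx.comp, ECtx.fill]

/-- Pairing is the only context former that can produce a value, and the components of a pair value
are values. -/
theorem ECtx.value_of_fill {k n : ℕ} (K : ECtx k n) {e : Exp k n} {v : Val n}
    (h : K.fill e = v.toExp) : ∃ u : Val n, e = u.toExp := by
  induction K generalizing v with
  | hole => exact ⟨v, h⟩
  | pairL K e' ih =>
    cases v with
    | atom a => simp [ECtx.fill, Val.toExp] at h
    | pair u v =>
      simp only [ECtx.fill, Val.toExp, Exp.pair.injEq] at h
      exact ih h.1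
  | pairR u K ih =>
    cases v with
    | atom a => simp [ECtx.fill, Val.toExp] at h
    | pair u v =>
      simp only [ECtx.fill, Val.toExp, Exp.pair.injEq] at h
      exact ih h.2
  | _ => cases v <;> simp [ECtx.fill, Val.toExp] at h

/-! ## Reduction -/

theorem HeadStep.not_value {v : CVal} {s s' : State} {a : Option CVal} {e' : CExp} :
    ¬ HeadStep v.toExp s a e' s' := by
  intro h
  generalize hx : (v.toExp : CExp) = x at h
  cases h <;> cases v <;> simp [Val.toExp] at hx

/-- In a redex every subexpression in evaluation position is already a value, so a nontrivial
context around `e` can form a redex only if `e` is a value. -/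
theorem HeadStep.fill_inv {K : ECtx 0 0} {e e' : CExp} {s s' : State} {a : Option CVal}
    (h : HeadStep (K.fill e) s a e' s') : K = .hole ∨ ∃ v : CVal, e = v.toExp := by
  -- Redexes mention locations, names and integers as bare atoms, which are values although not
  -- written with `toExp`.
  have atomic {K : ECtx 0 0} {b : Atom 0} (h : K.fill e = .atom b) : ∃ v : CVal, e = v.toExp :=
    K.value_of_fill (v := .atom b) h
  generalize hx : K.fill e = x at h
  cases h <;> cases K <;>
    simp only [ECtx.fill, Exp.app.injEq, Exp.ite.injEq, Exp.proj.injEq, Exp.ref.injEq,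
      Exp.deref.injEq, Exp.op.injEq, reduceCtorEq, true_or] at hx ⊢ <;>
    right <;>
    first
    | exact ECtx.value_of_fill _ hx
    | exact ECtx.value_of_fill _ hx.1
    | exact ECtx.value_of_fill _ hx.2
    | exact ECtx.value_of_fill _ hx.2.1
    | exact ECtx.value_of_fill _ hx.2.2
    | exact atomic hx
    | exact atomic hx.1
    | exact atomic hx.2.1
    | exact atomic hx.2
    | exact atomic hx.2.2
    | exact ECtx.value_of_fill (v := .pair _ _) _ hx.2

theorem Step.not_value {v : CVal} {s s' : State} {a : Option CVal} {e' : CExp} :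
    ¬ Step v.toExp s a e' s' := by
  intro h
  generalize hx : (v.toExp : CExp) = x at h
  obtain ⟨K, h⟩ := h
  obtain ⟨u, rfl⟩ := K.value_of_fill hx.symm
  exact h.not_value

theorem Val.irreducible (v : CVal) (s : State) : Irreducible v.toExp s :=
  fun _ _ _ h => h.not_value

theorem HeadStep.step {e e' : CExp} {s s' : State} {a : Option CVal} (h : HeadStep e s a e' s') :
    Step e s a e' s' :=
  .ctx .hole h

theorem Step.fill {e e' : CExp} {s s' : State} {a : Option CVal} (K : ECtx 0 0)
    (h : Step e s a e' s') : Step (K.fill e) s a (K.fill e') s' := by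
  obtain ⟨K', h⟩ := h
  rw [← K.fill_comp, ← K.fill_comp]
  exact .ctx _ h

/-- A proper context inside a redex would have a value in its hole, and values do not reduce. The
two states are unrelated: being a redex in one state rules out inner reductions in all. -/
theorem Step.headStep {e e₁ e₂ : CExp} {s s₁ s₂ s₃ : State} {a b : Option CVal}
    (h : HeadStep e s a e₁ s₁) (h' : Step e s₂ b e₂ s₃) : HeadStep e s₂ b e₂ s₃ := by
  obtain ⟨K, h'⟩ := h'
  rcases h.fill_inv with rfl | ⟨v, rfl⟩
  · exact h'
  · exact (h'.not_value).elim

/-- A redex inside `K[e]`, where `e` is not a value, lies inside `e`. -/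
theorem ECtx.decompose (K : ECtx 0 0) {K' : ECtx 0 0} {e r e' : CExp} {s s' : State}
    {a : Option CVal} (he : ¬ ∃ v : CVal, e = v.toExp) (hr : HeadStep r s a e' s')
    (h : K.fill e = K'.fill r) : ∃ K'', K' = K.comp K'' ∧ e = K''.fill r := by
  -- The context of the redex ends first, so `L[e]` is the redex itself; as `e` is not a value, `L`
  -- must be the hole.
  have hhole (L : ECtx 0 0) (h : L.fill e = r) :
      ∃ K'', ECtx.hole = L.comp K'' ∧ e = K''.fill r := by
    have hr' : HeadStep (L.fill e) s a e' s' := by rw [h]; exact hr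
    rcases hr'.fill_inv with rfl | h'
    · exact ⟨.hole, rfl, h⟩
    · exact (he h').elim
  -- If the contexts part ways, the hole of one lies in an operand that the other requires to be a
  -- value; neither the nonvalue `e` nor the redex `r` can occur there.
  have hval {L : ECtx 0 0} {v : CVal} (h : L.fill e = v.toExp) : False := he (L.value_of_fill h)
  have hval' {L : ECtx 0 0} {v : CVal} (h : v.toExp = L.fill r) : False := by
    obtain ⟨v, rfl⟩ := L.value_of_fill h.symm
    exact hr.not_value
  induction K generalizing K' with
  | hole => exact ⟨K', rfl, h⟩
  | _ =>
    rename_i ih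
    cases K'
    case hole => exact hhole _ h
    all_goals
      simp only [ECtx.fill, Exp.app.injEq, Exp.ite.injEq, Exp.proj.injEq, Exp.ref.injEq,
        Exp.pair.injEq, Exp.deref.injEq, Exp.op.injEq, reduceCtorEq,
        Val.toExp_injective.eq_iff] at h
      try first
        | exact (hval h.1).elim
        | exact (hval h.2.1).elim
        | exact (hval' h.1).elim
        | exact (hval' h.2.1).elim
    all_goals
      first
      | replace ih := ih h
      | replace ih := ih h.1
      | replace ih := ih h.2
      | replace ih := ih h.2.1
      | replace ih := ih h.2.2
      obtain ⟨K'', hK, he'⟩ := ih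
      exact ⟨K'', by simp [ECtx.comp, hK, h], he'⟩

theorem Step.fill_inv (K : ECtx 0 0) {e x : CExp} {s s' : State} {a : Option CVal}
    (he : ¬ ∃ v : CVal, e = v.toExp) (h : Step (K.fill e) s a x s') :
    ∃ e', Step e s a e' s' ∧ x = K.fill e' := by
  generalize hx : K.fill e = y at h
  obtain ⟨K', h⟩ := h
  obtain ⟨K'', rfl, rfl⟩ := K.decompose he h hx
  exact ⟨_, .ctx K'' h, K.fill_comp _ _⟩

/-! ## Resources -/

theorem TraceRes.Comp.symm {a b c : TraceRes} (h : Comp a b c) : Comp b a c := by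
  cases h with
  | histL h => exact .histR h
  | histR h => exact .histL h
  | ownL h => exact .ownR h
  | ownR h => exact .ownL h

theorem Res.Comp.symm {a b c : Res} (h : Comp a b c) : Comp b a c :=
  ⟨h.disj.symm, by rw [h.heap, Finmap.union_comm_of_disjoint h.disj], h.tr.symm⟩

theorem Res.Comp.assoc' {a b c bc d : Res} (h : Comp b c bc) (h' : Comp a bc d) :
    ∃ ab, Comp a b ab ∧ Comp ab c d := by
  obtain ⟨x, hx, hx'⟩ := h.symm.assoc h'.symm
  exact ⟨x, hx.symm, hx'.symm⟩

/-- Owned traces are maximal: only a history composes with `own t`, and it leaves it unchanged. -/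
theorem TraceRes.own_le {t : Trace} {τ : TraceRes} : .own t ≤ τ ↔ τ = .own t := by
  constructor
  · rintro ⟨c, h⟩; cases h; rfl
  · rintro rfl; exact le_rfl

theorem TraceRes.hist_le_hist {t t' : Trace} : hist t ≤ hist t' ↔ t <+: t' := by
  constructor
  · rintro ⟨c, h⟩
    cases h with
    | histL h => exact List.prefix_rfl
    | histR h => exact h
  · exact fun h => ⟨_, .histR h⟩

/-- A history below `τ` records a prefix of the trace in `τ` and is absorbed by it. This makes
histories duplicable. -/
theorem TraceRes.comp_hist {t : Trace} {τ : TraceRes} (h : .hist t ≤ τ) : Comp τ (.hist t) τ := by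
  obtain ⟨c, h⟩ := h
  cases h with
  | histL h => exact .histL List.prefix_rfl
  | histR h => exact .histL h
  | ownR h => exact .ownL h

/-- A frame beside an owned trace knows only a prefix of it, and this remains a prefix when the
owner extends the trace. -/
theorem TraceRes.Comp.own_inv {t : Trace} {r c : TraceRes} (h : Comp (.own t) r c) :
    c = .own t ∧ ∃ t', r = .hist t' ∧ t' <+: t := by
  cases h with
  | ownL h => exact ⟨rfl, _, rfl, h⟩

/-- Changing only the state and the heap part of the resource. -/
theorem ErasesFrame.update_heap {t : Trace} {h : Heap} {γ : FEnv} {w : World} {m r : Res}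
    (H : ErasesFrame t (h, γ) w m r) {h₁ : Heap} (hd : h₁.Disjoint r.heap) :
    ErasesFrame t (h₁ ∪ r.heap, γ) w ⟨h₁, m.tr⟩ r := by
  obtain ⟨c, hc, h1, h2, h3⟩ := H
  exact ⟨⟨h₁ ∪ r.heap, c.tr⟩, ⟨hd, rfl, hc.tr⟩, h1, rfl, h3⟩

theorem ErasesFrame.heap_eq {t : Trace} {s : State} {w : World} {m r : Res}
    (H : ErasesFrame t s w m r) : s.1 = m.heap ∪ r.heap ∧ m.heap.Disjoint r.heap := by
  obtain ⟨c, hc, h1, h2, h3⟩ := H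
  exact ⟨h2.trans hc.heap, hc.disj⟩

theorem exists_notMem_finmap {β : Type} (f : Finmap fun _ : ℕ => β) : ∃ l, l ∉ f := by
  obtain ⟨l, hl⟩ := Infinite.exists_notMem_finset f.keys
  exact ⟨l, fun h => hl (Finmap.mem_keys.2 h)⟩

/-! ## Weakest preconditions -/

theorem wp_unfold {Q : CVal → SProp} {e : CExp} {w : World} {m : Res} :
    m ∈ wp Q e w ↔ m ∈ wpStep Q (wp Q) e w := by
  have h := OrderHom.map_gfp ⟨wpStep Q, wpStep_mono Q⟩
  exact iff_of_eq (congrArg (fun X => m ∈ X e w) h.symm)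

/-- Coinduction up to `wp`: after a step one may leave the candidate `X` for `wp Q` itself, because
`X ⊔ wp Q` is then a post-fixed point. -/
theorem wp_coind {Q : CVal → SProp} (X : CExp → World → Set Res)
    (h : ∀ e w m, m ∈ X e w → m ∈ wpStep Q (X ⊔ wp Q) e w) {e : CExp} {w : World} {m : Res}
    (hm : m ∈ X e w) : m ∈ wp Q e w := by
  have key : X ⊔ wp Q ≤ OrderHom.gfp ⟨wpStep Q, wpStep_mono Q⟩ := by
    apply OrderHom.le_gfp
    intro e w m hm
    rcases hm with hm | hm
    · exact h e w m hm
    · exact wpStep_mono Q le_sup_right e w (wp_unfold.1 hm)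
  exact key e w (Or.inl hm)

theorem wp_value {Q : CVal → SProp} {v : CVal} {w : World} {m : Res} (h : (w, m) ∈ Q v) :
    m ∈ wp Q v.toExp w :=
  wp_unfold.2 fun _ _ _ _ => ⟨fun _ => ⟨v, rfl, h⟩, fun _ _ _ hs => hs.not_value.elim⟩

/-- Monotonicity combined with framing. -/
theorem wp_frame_mono {Q Q' : CVal → SProp} {e : CExp} {w : World} {m f c : Res}
    (hm : m ∈ wp Q e w) (hc : Res.Comp m f c)
    (hQ : ∀ w' ≥ w, ∀ v m' c', (w', m') ∈ Q v → Res.Comp m' f c' → (w', c') ∈ Q' v) :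
    c ∈ wp Q' e w := by
  -- The candidate consists of the products `m • f` with `f` fixed throughout the execution.
  refine wp_coind (fun e w₁ => {c | w ≤ w₁ ∧ ∃ m, Res.Comp m f c ∧ m ∈ wp Q e w₁}) ?_
    ⟨le_rfl, m, hc, hm⟩
  rintro e w₁ c ⟨hw, m, hc, hm⟩ r t s ⟨d, hd, hs⟩
  -- The resource `f • r` serves as the frame of `m`; the quantification over frames in `wpStep`
  -- allows this.
  obtain ⟨x, hx, hx'⟩ := hc.assoc hd
  obtain ⟨h₁, h₂⟩ := wp_unfold.1 hm x t s ⟨d, hx', hs⟩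
  refine ⟨fun hi => ?_, fun a e' s' hstep => ?_⟩
  · obtain ⟨v, rfl, hv⟩ := h₁ hi
    exact ⟨v, rfl, hQ w₁ hw v m c hv hc⟩
  · obtain ⟨w', hw', m', ⟨d', hd', hs'⟩, hm'⟩ := h₂ a e' s' hstep
    obtain ⟨y, hy, hy'⟩ := hx.assoc' hd'
    exact ⟨w', hw', y, ⟨d', hy', hs'⟩, Or.inl ⟨hw.trans hw', m', hy, hm'⟩⟩

theorem wp_mono {Q Q' : CVal → SProp} {e : CExp} {w : World} {m : Res} (hm : m ∈ wp Q e w)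
    (hQ : ∀ w' ≥ w, ∀ v m', (w', m') ∈ Q v → (w', m') ∈ Q' v) : m ∈ wp Q' e w :=
  wp_frame_mono hm (.unit m) fun w' hw' v m' _ h hc =>
    -- The product of `m'` with the unit lies above `m'`, so upward closure of the postcondition
    -- suffices.
    (Q' v).upper (a := (w', m')) ⟨le_rfl, _, hc⟩ (hQ w' hw' v m' h)

theorem wp_bind {Q R : CVal → SProp} {K : ECtx 0 0} {e : CExp} {w : World} {m : Res}
    (hm : m ∈ wp Q e w)
    (hK : ∀ w' ≥ w, ∀ v m', (w', m') ∈ Q v → m' ∈ wp R (K.fill v.toExp) w') :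
    m ∈ wp R (K.fill e) w := by
  -- The candidate describes the phase in which `e` is still running inside `K`; once `e` is a
  -- value, `hK` moves the proof over to `wp R`.
  refine wp_coind (fun x w₁ => {m | w ≤ w₁ ∧ ∃ e, x = K.fill e ∧ m ∈ wp Q e w₁}) ?_
    ⟨le_rfl, e, rfl, hm⟩
  rintro _ w₁ m ⟨hw, e, rfl, hm⟩ r t s hs
  obtain ⟨h₁, h₂⟩ := wp_unfold.1 hm r t s hs
  by_cases he : ∃ v : CVal, e = v.toExp
  · obtain ⟨v, rfl⟩ := he
    obtain ⟨u, hu, hv⟩ := h₁ (v.irreducible s)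
    obtain rfl := Val.toExp_injective hu
    exact wpStep_mono R le_sup_right _ _ (wp_unfold.1 (hK w₁ hw v m hv)) r t s hs
  · refine ⟨fun hi => ?_, fun a x s' hstep => ?_⟩
    -- If `K[e]` is irreducible, so is `e`, and then `wp Q` would make it a value.
    · obtain ⟨v, hv, -⟩ := h₁ fun a e' s' h => hi _ _ _ (h.fill K)
      exact (he ⟨v, hv⟩).elim
    · obtain ⟨e', he', rfl⟩ := hstep.fill_inv K he
      obtain ⟨w', hw', m', hf, hm'⟩ := h₂ a e' s' he'
      exact ⟨w', hw', m', hf, Or.inl ⟨hw.trans hw', e', rfl, hm'⟩⟩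

/-- To prove a weakest precondition of a redex it suffices to consider its reduction. -/
theorem wp_head {Q : CVal → SProp} {e : CExp} {w : World} {m : Res}
    (h : ∀ r t s, ErasesFrame t s w m r → (∃ a e' s', HeadStep e s a e' s') ∧
      ∀ a e' s', HeadStep e s a e' s' →
        ∃ w' ≥ w, ∃ m', ErasesFrame (t ++ a.toList) s' w' m' r ∧ m' ∈ wp Q e' w') :
    m ∈ wp Q e w := by
  refine wp_unfold.2 fun r t s hs => ?_
  obtain ⟨⟨a, e₁, s₁, h₁⟩, h₂⟩ := h r t s hs
  exact ⟨fun hi => (hi _ _ _ h₁.step).elim, fun b e' s' hstep => h₂ b e' s' (hstep.headStep h₁)⟩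

/-- A silent reduction that neither depends on the state nor changes it. -/
theorem wp_pure {Q : CVal → SProp} {e e' : CExp} {w : World} {m : Res}
    (h₁ : ∀ s, HeadStep e s none e' s)
    (h₂ : ∀ s a e'' s', HeadStep e s a e'' s' → a = none ∧ e'' = e' ∧ s' = s)
    (hm : m ∈ wp Q e' w) : m ∈ wp Q e w := by
  refine wp_head fun r t s hs => ⟨⟨_, _, _, h₁ s⟩, fun a e'' s' h => ?_⟩
  obtain ⟨rfl, rfl, rfl⟩ := h₂ _ _ _ _ h
  exact ⟨w, le_rfl, m, by simpa using hs, hm⟩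

/-! ### Weakest preconditions of the individual redexes -/

theorem wp_lam {Q : CVal → SProp} {e : Exp 0 1} {w : World} {m : Res}
    (h : ∀ w' ≥ w, ∀ f, w'.env.lookup f = some e → (w', m) ∈ Q (.atom (.fn f))) :
    m ∈ wp Q (.lam e) w := by
  refine wp_head fun r t ⟨hp, γ⟩ hs => ?_
  obtain ⟨c, hc, h1, h2, h3, h4⟩ := hs
  -- This name only shows that a reduction exists; the reduction under consideration may choose
  -- another fresh name `g`.
  obtain ⟨f, hf⟩ := exists_notMem_finmap γ
  refine ⟨⟨_, _, _, .lam e hp γ f hf⟩, fun a e' s' hstep => ?_⟩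
  cases hstep with
  | lam _ _ _ g hg =>
    -- Freshness of `g` ensures that no earlier binding is overwritten, so the extended environment
    -- is a later world.
    have hw : w ≤ ⟨γ.insert g e, w.inv⟩ := by
      refine ⟨fun f' e' hf' => ?_, rfl⟩
      rw [← show γ = w.env from h3] at hf'
      have : f' ≠ g := by
        rintro rfl
        exact hg (Finmap.mem_of_lookup_eq_some hf')
      simpa [Finmap.lookup_insert_of_ne _ this] using hf'
    exact ⟨⟨γ.insert g e, w.inv⟩, hw, m, ⟨c, hc, by simpa using h1, h2, rfl, by simpa using h4⟩,
      wp_value (v := .atom (.fn g)) (h _ hw g (Finmap.lookup_insert _))⟩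

theorem wp_app {Q : CVal → SProp} {e : Exp 0 1} {w : World} {m : Res} {f : ℕ} {v : CVal}
    (hf : w.env.lookup f = some e) (h : m ∈ wp Q (e.inst v) w) :
    m ∈ wp Q (.app (.atom (.fn f)) v.toExp) w := by
  refine wp_head fun r t ⟨hp, γ⟩ hs => ?_
  obtain ⟨c, hc, h1, h2, rfl, h4⟩ := id hs
  refine ⟨⟨_, _, _, .app f v e hp _ hf⟩, fun a e' s' hstep => ?_⟩
  generalize hx : (v.toExp : CExp) = x at hstep
  cases hstep with
  | app _ u e₁ _ _ hf' =>
    obtain rfl := Val.toExp_injective hx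
    rw [hf, Option.some.injEq] at hf'
    subst hf'
    exact ⟨w, le_rfl, m, by simpa using hs, h⟩

theorem wp_proj {Q : CVal → SProp} {w : World} {m : Res} {i : Fin 2} {v : Fin 2 → CVal}
    (h : (w, m) ∈ Q (v i)) : m ∈ wp Q (.proj i (.pair (v 0).toExp (v 1).toExp)) w := by
  refine wp_pure (fun s => .proj i v s) (fun s a e'' s' hstep => ?_) (wp_value h)
  generalize hx : ((v 0).toExp : CExp) = x at hstep
  generalize hy : ((v 1).toExp : CExp) = y at hstep
  cases hstep with
  | proj _ u _ =>
    have hx := Val.toExp_injective hx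
    have hy := Val.toExp_injective hy
    have : v = u := by funext j; fin_cases j <;> assumption
    simp [this]

theorem wp_itePos {Q : CVal → SProp} {w : World} {m : Res} {z : ℤ} (hz : 0 < z) {e₁ e₂ : CExp}
    (h : m ∈ wp Q e₁ w) : m ∈ wp Q (.ite (.atom (.int z)) e₁ e₂) w := by
  refine wp_pure (fun s => .itePos z hz e₁ e₂ s) (fun s a e'' s' hstep => ?_) h
  cases hstep with
  | itePos => exact ⟨rfl, rfl, rfl⟩
  | iteZero => exact (lt_irrefl _ hz).elim

theorem wp_iteZero {Q : CVal → SProp} {w : World} {m : Res} {e₁ e₂ : CExp}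
    (h : m ∈ wp Q e₂ w) : m ∈ wp Q (.ite (.atom (.int 0)) e₁ e₂) w := by
  refine wp_pure (fun s => .iteZero e₁ e₂ s) (fun s a e'' s' hstep => ?_) h
  cases hstep with
  | itePos _ hz => exact (lt_irrefl _ hz).elim
  | iteZero => exact ⟨rfl, rfl, rfl⟩

/-- The new location is fresh for the whole heap, hence also for the frame, so the enlarged heap
remains disjoint from the frame. The postcondition only learns that it is fresh for `m`. -/
theorem wp_ref {Q : CVal → SProp} {v : CVal} {w : World} {m : Res}
    (h : ∀ l, l ∉ m.heap → (w, ⟨m.heap.insert l v, m.tr⟩) ∈ Q (.atom (.loc l))) :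
    m ∈ wp Q (.ref v.toExp) w := by
  refine wp_head fun r t ⟨hp, γ⟩ hs => ?_
  obtain ⟨l, hl⟩ := exists_notMem_finmap hp
  refine ⟨⟨_, _, _, .ref v hp γ l hl⟩, fun a e' s' hstep => ?_⟩
  generalize hx : (v.toExp : CExp) = x at hstep
  cases hstep with
  | ref u _ _ l hl =>
    obtain rfl := Val.toExp_injective hx
    obtain ⟨rfl, hd⟩ := hs.heap_eq
    rw [Finmap.mem_union, not_or] at hl
    refine ⟨w, le_rfl, _, ?_, wp_value (v := .atom (.loc l)) (h l hl.1)⟩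
    have hd' : (m.heap.insert l v).Disjoint r.heap := by
      intro k hk hk'
      rcases Finmap.mem_insert.1 hk with rfl | hk
      · exact hl.2 hk'
      · exact hd k hk hk'
    simpa [Finmap.insert_union] using hs.update_heap hd'

theorem wp_deref {Q : CVal → SProp} {l : ℕ} {v : CVal} {w : World} {m : Res}
    (hl : m.heap.lookup l = some v) (h : (w, m) ∈ Q v) : m ∈ wp Q (.deref (.atom (.loc l))) w := by
  refine wp_head fun r t ⟨hp, γ⟩ hs => ?_
  have hl' : hp.lookup l = some v := by
    obtain ⟨rfl, hd⟩ := hs.heap_eq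
    rw [Finmap.lookup_union_left (Finmap.mem_of_lookup_eq_some hl), hl]
  refine ⟨⟨_, _, _, .deref l v hp γ hl'⟩, fun a e' s' hstep => ?_⟩
  cases hstep with
  | deref _ u _ _ hu =>
    obtain rfl : v = u := by simpa [hl'] using hu
    exact ⟨w, le_rfl, m, by simpa using hs, wp_value h⟩

theorem wp_assign {Q : CVal → SProp} {l : ℕ} {v : CVal} {w : World} {m : Res} (hl : l ∈ m.heap)
    (h : (w, ⟨m.heap.insert l v, m.tr⟩) ∈ Q (.atom .unit)) :
    m ∈ wp Q (.op .assign (.atom (.loc l)) v.toExp) w := by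
  refine wp_head fun r t ⟨hp, γ⟩ hs => ?_
  obtain ⟨rfl, hd⟩ := hs.heap_eq
  refine ⟨⟨_, _, _, .assign l v _ γ (Finmap.mem_union.2 (.inl hl))⟩, fun a e' s' hstep => ?_⟩
  generalize hx : (v.toExp : CExp) = x at hstep
  cases hstep with
  | assign _ u _ _ _ =>
    obtain rfl := Val.toExp_injective hx
    refine ⟨w, le_rfl, _, ?_, wp_value (v := .atom .unit) h⟩
    -- Since `l` already belongs to `m.heap`, the update does not enlarge the domain.
    have hd' : (m.heap.insert l v).Disjoint r.heap := by
      intro k hk hk'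
      rcases Finmap.mem_insert.1 hk with rfl | hk
      · exact hd _ hl hk'
      · exact hd k hk hk'
    simpa [Finmap.insert_union] using hs.update_heap hd'

/-- Arbitrary operands `x` and `y` allow a direct case analysis; injectivity of `Val.toExp` turns
inequality of values into inequality of expressions. -/
theorem HeadStep.eq_inv {x y e' : CExp} {s s' : State} {a : Option CVal}
    (h : HeadStep (.op .eq x y) s a e' s') : a = none ∧ s' = s ∧
      (x = y ∧ e' = .atom (.int 1) ∨ x ≠ y ∧ e' = .atom (.int 0)) := by
  cases h with
  | eqTrue => exact ⟨rfl, rfl, .inl ⟨rfl, rfl⟩⟩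
  | eqFalse _ _ h => exact ⟨rfl, rfl, .inr ⟨fun h' => h (Val.toExp_injective h'), rfl⟩⟩

theorem wp_eq {Q : CVal → SProp} {u v : CVal} {w : World} {m : Res}
    (h₁ : u = v → (w, m) ∈ Q (.atom (.int 1))) (h₂ : u ≠ v → (w, m) ∈ Q (.atom (.int 0))) :
    m ∈ wp Q (.op .eq u.toExp v.toExp) w := by
  by_cases huv : u = v
  · subst huv
    refine wp_pure (fun s => .eqTrue u s) (fun s a e'' s' hstep => ?_)
      (wp_value (v := .atom (.int 1)) (h₁ rfl))
    obtain ⟨ha, hs, h | h⟩ := hstep.eq_inv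
    · exact ⟨ha, h.2, hs⟩
    · exact (h.1 rfl).elim
  · refine wp_pure (fun s => .eqFalse u v huv s) (fun s a e'' s' hstep => ?_)
      (wp_value (v := .atom (.int 0)) (h₂ huv))
    obtain ⟨ha, hs, h | h⟩ := hstep.eq_inv
    · exact (huv (Val.toExp_injective h.1)).elim
    · exact ⟨ha, h.2, hs⟩

theorem wp_add {Q : CVal → SProp} {a b : ℤ} {w : World} {m : Res}
    (h : (w, m) ∈ Q (.atom (.int (a + b)))) :
    m ∈ wp Q (.op .add (.atom (.int a)) (.atom (.int b))) w := by
  refine wp_pure (fun s => .add a b s) (fun s _ e'' s' hstep => ?_) (wp_value (v := .atom _) h)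
  cases hstep; exact ⟨rfl, rfl, rfl⟩

theorem wp_sub {Q : CVal → SProp} {a b : ℤ} {w : World} {m : Res}
    (h : (w, m) ∈ Q (.atom (.int (a - b)))) :
    m ∈ wp Q (.op .sub (.atom (.int a)) (.atom (.int b))) w := by
  refine wp_pure (fun s => .sub a b s) (fun s _ e'' s' hstep => ?_) (wp_value (v := .atom _) h)
  cases hstep; exact ⟨rfl, rfl, rfl⟩

theorem wp_mul {Q : CVal → SProp} {a b : ℤ} {w : World} {m : Res}
    (h : (w, m) ∈ Q (.atom (.int (a * b)))) :
    m ∈ wp Q (.op .mul (.atom (.int a)) (.atom (.int b))) w := by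
  refine wp_pure (fun s => .mul a b s) (fun s _ e'' s' hstep => ?_) (wp_value (v := .atom _) h)
  cases hstep; exact ⟨rfl, rfl, rfl⟩

theorem wp_emit {Q : CVal → SProp} {v : CVal} {w : World} {m : Res} {t : Trace}
    (hm : m.tr = .own t) (ht : t ++ [v] ∈ w.inv)
    (h : (w, ⟨m.heap, .own (t ++ [v])⟩) ∈ Q (.atom .unit)) : m ∈ wp Q (.emit v) w := by
  refine wp_head fun r t₁ s hs => ⟨⟨_, _, _, .emit v s⟩, fun a e' s' hstep => ?_⟩
  cases hstep
  obtain ⟨c, hc, h1, h2⟩ := hs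
  have hct := hc.tr
  rw [hm] at hct
  obtain ⟨hc', t', ht', hp⟩ := hct.own_inv
  rw [hc'] at h1
  -- The whole product owns `t`, so erasure forces the actual trace to be `t`.
  obtain rfl : t₁ = t := h1
  refine ⟨w, le_rfl, ⟨m.heap, .own (t₁ ++ [v])⟩,
    ⟨⟨c.heap, .own (t₁ ++ [v])⟩, ⟨hc.disj, hc.heap, ?_⟩, rfl, h2.1, h2.2.1, ht⟩,
    wp_value (v := .atom .unit) h⟩
  rw [ht']
  exact .ownL (hp.trans (List.prefix_append _ _))

/-- Adequacy of weakest preconditions for executions to irreducible configurations. -/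
theorem wp_adequacy {Q : CVal → SProp} {e e' : CExp} {s s' : State} {t t' : Trace} {w : World}
    {m r : Res} (hred : Steps e s t' e' s') (hirr : Irreducible e' s') (hm : m ∈ wp Q e w)
    (hs : ErasesFrame t s w m r) :
    ∃ v : CVal, e' = v.toExp ∧ ∃ w' ≥ w, ∃ m' : Res, (w', m') ∈ Q v ∧
      ErasesFrame (t ++ t') s' w' m' r := by
  induction hred generalizing t w m with
  | refl e s =>
    obtain ⟨v, hv, hQ⟩ := (wp_unfold.1 hm r t s hs).1 hirr
    exact ⟨v, hv, w, le_rfl, m, hQ, by simpa using hs⟩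
  | head h _ ih =>
    obtain ⟨w₁, hw₁, m₁, hs₁, hm₁⟩ := (wp_unfold.1 hm r t _ hs).2 _ _ _ h
    obtain ⟨v, hv, w', hw', m', hQ, hs'⟩ := ih hirr hm₁ hs₁
    exact ⟨v, hv, w', hw₁.trans hw', m', hQ, by simpa using hs'⟩

/-! ## Renaming and substitution in the semantics of terms -/

theorem Env.cons_lift {Γ Δ : List Ty} {σ : Ty} (ξ : Ren Γ Δ) (a : σ.denote) (ρ : Env Δ) :
    (fun τ x => Env.cons a ρ τ (ξ.lift τ x)) = Env.cons a fun τ x => ρ τ (ξ τ x) := by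
  funext τ x
  cases x <;> rfl

theorem Tm.denote_rename {Γ Δ : List Ty} {τ : Ty} (M : Tm Γ τ) (ξ : Ren Γ Δ) (ρ : Env Δ) :
    (M.rename ξ).denote ρ = M.denote fun τ x => ρ τ (ξ τ x) := by
  induction M generalizing Δ <;> simp only [Tm.rename, Tm.denote, Env.cons_lift, *]

@[simp]
theorem Tm.denote_wk {Γ : List Ty} {σ τ : Ty} (M : Tm Γ τ) (a : σ.denote) (ρ : Env Γ) :
    M.wk.denote (Env.cons a ρ) = M.denote ρ :=
  M.denote_rename _ _

@[simp]
theorem Tm.denote_wk₁ {Γ : List Ty} {σ σ' τ : Ty} (M : Tm (σ :: Γ) τ) (a : σ.denote)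
    (b : σ'.denote) (ρ : Env Γ) :
    M.wk₁.denote (Env.cons a (Env.cons b ρ)) = M.denote (Env.cons a ρ) := by
  rw [M.denote_rename, Env.cons_lift]
  rfl

theorem Env.cons_lift_sub {Γ Δ : List Ty} {σ : Ty} (θ : Sub Γ Δ) (a : σ.denote) (ρ : Env Δ) :
    (fun τ x => (θ.lift τ x).denote (Env.cons a ρ)) =
      Env.cons a fun τ x => (θ τ x).denote ρ := by
  funext τ x
  cases x with
  | zero => rfl
  | succ x => exact Tm.denote_wk _ _ _

theorem Tm.denote_subst {Γ Δ : List Ty} {τ : Ty} (M : Tm Γ τ) (θ : Sub Γ Δ) (ρ : Env Δ) :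
    (M.subst θ).denote ρ = M.denote fun τ x => (θ τ x).denote ρ := by
  induction M generalizing Δ <;> simp only [Tm.subst, Tm.denote, Env.cons_lift_sub, *]

theorem Env.one {Γ : List Ty} {σ : Ty} (M : Tm Γ σ) (ρ : Env Γ) :
    (fun τ x => (Sub.one M τ x).denote ρ) = Env.cons (M.denote ρ) ρ := by
  funext τ x
  cases x <;> rfl

@[simp]
theorem Tm.denote_inst {Γ : List Ty} {σ τ : Ty} (N : Tm (σ :: Γ) τ) (M : Tm Γ σ) (ρ : Env Γ) :
    (N.inst M).denote ρ = N.denote (Env.cons (M.denote ρ) ρ) := by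
  rw [N.denote_subst, Env.one]

/-! ### Semantics of the sequence abbreviations and of constants -/

theorem Tm.denote_append {Γ : List Ty} {τ : Ty} (M N : Tm Γ (.seq τ)) (ρ : Env Γ) :
    (M.append N).denote ρ = ((M.denote ρ : List τ.denote) ++ (N.denote ρ : List τ.denote)) := by
  have h (l l' : List τ.denote) : l.foldr (fun x acc => x :: acc) l' = l ++ l' := by
    induction l <;> simp_all
  exact h _ _

theorem Tm.denote_snoc {Γ : List Ty} {τ : Ty} (M : Tm Γ (.seq τ)) (N : Tm Γ τ) (ρ : Env Γ) :
    (M.snoc N).denote ρ = ((M.denote ρ : List τ.denote) ++ [N.denote ρ]) :=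
  Tm.denote_append _ _ _

theorem Tm.denote_const {Γ : List Ty} (v : CVal) (ρ : Env Γ) :
    (Tm.const v : Tm Γ .val).denote ρ = v :=
  v.subst_closed _

theorem Tm.mem_denote_pref {Γ : List Ty} {τ : Ty} (M N : Tm Γ (.seq τ)) (ρ : Env Γ)
    (p : World × Res) : p ∈ ((M.pref (k := .prop) N).denote ρ : SProp) ↔
      (M.denote ρ : List τ.denote) <+: (N.denote ρ : List τ.denote) := by
  have h (l : List τ.denote) : ((M.wk.append v₀).denote (Env.cons (σ := .seq τ) l ρ) =
      N.wk.denote (Env.cons (σ := .seq τ) l ρ)) ↔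
      (M.denote ρ : List τ.denote) ++ l = (N.denote ρ : List τ.denote) := by
    rw [Tm.denote_append, Tm.denote_wk, Tm.denote_wk]; rfl
  exact exists_congr h

/-! ## Validity of judgements -/

def Ctx.Sat {Γ : List Ty} (Θ : List (Tm Γ .spec)) (ρ : Env Γ) (w : World) : Prop :=
  ∀ S ∈ Θ, w ∈ (S.denote ρ : SSpec)

theorem Ctx.Sat.mono {Γ : List Ty} {Θ : List (Tm Γ .spec)} {ρ : Env Γ} {w w' : World}
    (h : Ctx.Sat Θ ρ w) (hw : w ≤ w') : Ctx.Sat Θ ρ w' :=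
  fun S hS => (S.denote ρ : SSpec).upper hw (h S hS)

theorem Ctx.Sat.cons {Γ : List Ty} {Θ : List (Tm Γ .spec)} {ρ : Env Γ} {w : World}
    {S : Tm Γ .spec} (hS : w ∈ (S.denote ρ : SSpec)) (h : Ctx.Sat Θ ρ w) :
    Ctx.Sat (S :: Θ) ρ w :=
  List.forall_mem_cons.2 ⟨hS, h⟩

theorem Ctx.Sat.wk {Γ : List Ty} {Θ : List (Tm Γ .spec)} {ρ : Env Γ} {w : World}
    (h : Ctx.Sat Θ ρ w) {σ : Ty} (a : σ.denote) : Ctx.Sat (Ctx.wk Θ) (Env.cons a ρ) w := by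
  intro S hS
  obtain ⟨T, hT, rfl⟩ := List.mem_map.1 hS
  rw [Tm.denote_wk]
  exact h T hT

/-- The truth of a conclusion under an environment at a world. -/
def Concl.Sat {Γ : List Ty} (J : Concl Γ) (ρ : Env Γ) (w : World) : Prop :=
  match J with
  | .holds S => w ∈ (S.denote ρ : SSpec)
  | .entails P Q => ∀ m : Res, (w, m) ∈ (P.denote ρ : SProp) → (w, m) ∈ (Q.denote ρ : SProp)

theorem Concl.sat_subst {Γ Δ : List Ty} (J : Concl Γ) (θ : Sub Γ Δ) (ρ : Env Δ) (w : World) :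
    (J.subst θ).Sat ρ w ↔ J.Sat (fun τ x => (θ τ x).denote ρ) w := by
  cases J <;> simp only [Concl.subst, Concl.Sat, Tm.denote_subst]

theorem Concl.sat_wk {Γ : List Ty} {σ : Ty} (J : Concl Γ) (a : σ.denote) (ρ : Env Γ) (w : World) :
    J.wk.Sat (Env.cons a ρ) w ↔ J.Sat ρ w := by
  cases J <;> simp only [Concl.wk, Concl.Sat, Tm.denote_wk]

/-- Semantic validity of a judgement. -/
def Valid {Γ : List Ty} (Θ : List (Tm Γ .spec)) (J : Concl Γ) : Prop :=
  ∀ ρ w, Ctx.Sat Θ ρ w → J.Sat ρ w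

theorem Valid.subst {Γ Δ : List Ty} {Θ : List (Tm Γ .spec)} {J : Concl Γ} (h : Valid Θ J)
    (θ : Sub Γ Δ) : Valid (Θ.map fun S => S.subst θ) (J.subst θ) := by
  intro ρ w hΘ
  rw [Concl.sat_subst]
  refine h _ w fun S hS => ?_
  rw [← Tm.denote_subst]
  exact hΘ _ (List.mem_map_of_mem hS)

open Concl

/-! ### Validity of the rules for Hoare triples -/

section Triples

variable {Γ : List Ty} {Θ : List (Tm Γ .spec)}

/-- Contexts persist to later worlds, so the quantifier over later worlds in a triple is absorbed by
the one over all worlds in `Valid`. -/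
theorem valid_triple {P : Tm Γ .prop} {e : Tm Γ .exp} {Q : Tm Γ (.fn .val .prop)} :
    Valid Θ (holds (.triple P e Q)) ↔ ∀ ρ w, Ctx.Sat Θ ρ w → ∀ m : Res,
      (w, m) ∈ (P.denote ρ : SProp) → m ∈ wp (Q.denote ρ) (e.denote ρ) w :=
  ⟨fun h ρ w hΘ m hm => h ρ w hΘ w le_rfl m hm, fun h ρ _ hΘ w' hw m hm =>
    h ρ w' (hΘ.mono hw) m hm⟩

/-- The assertion `spec S` ignores the resource and can join the context; upward closure lets `P`
hold of the whole resource. -/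
theorem Valid.specOut {S : Tm Γ .spec} {P : Tm Γ .prop} {e : Tm Γ .exp}
    {R : Tm Γ (.fn .val .prop)} (h : Valid (S :: Θ) (holds (.triple P e R))) :
    Valid Θ (holds (.triple (.star P (.spec S)) e R)) := by
  rw [valid_triple] at *
  rintro ρ w hΘ m ⟨m₁, m₂, h₁, h₂, hc⟩
  exact h ρ w (hΘ.cons h₂) m
    ((P.denote ρ : SProp).upper (a := (w, m₁)) ⟨le_rfl, _, hc⟩ h₁)

theorem Valid.frame {P : Tm Γ .prop} {e : Tm Γ .exp} {Q : Tm Γ (.fn .val .prop)}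
    (R : Tm Γ .prop) (h : Valid Θ (holds (.triple P e Q))) :
    Valid Θ (holds (.triple (.star P R) e (.lam (.star (.app Q.wk v₀) R.wk)))) := by
  rw [valid_triple] at *
  rintro ρ w hΘ m ⟨m₁, m₂, h₁, h₂, hc⟩
  refine wp_frame_mono (h ρ w hΘ m₁ h₁) hc fun w' hw' v m' c' hm' hc' => ⟨m', m₂, ?_, ?_, hc'⟩
  · simp only [Tm.denote, Tm.denote_wk]
    exact hm'
  · rw [Tm.denote_wk]
    -- The framed assertion survives the growth of the world by monotonicity.
    exact (R.denote ρ : SProp).upper (a := (w, m₂)) ⟨hw', le_rfl⟩ h₂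

theorem Valid.csq {P₁ P₂ : Tm Γ .prop} {e : Tm Γ .exp} {Q₁ Q₂ : Tm Γ (.fn .val .prop)}
    (h₁ : Valid Θ (entails P₁ P₂)) (h₂ : Valid Θ (holds (.triple P₂ e Q₂)))
    (h₃ : Valid (Ctx.wk Θ) (entails (.app Q₂.wk v₀) (.app (Q₁.wk (σ := .val)) v₀))) :
    Valid Θ (holds (.triple P₁ e Q₁)) := by
  rw [valid_triple] at *
  intro ρ w hΘ m hm
  refine wp_mono (h₂ ρ w hΘ m (h₁ ρ w hΘ m hm)) fun w' hw' v m' hm' => ?_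
  have := h₃ (Env.cons (σ := .val) v ρ) w' ((hΘ.mono hw').wk _) m'
  simp only [Tm.denote, Tm.denote_wk] at this
  exact this hm'

theorem Valid.exPre {τ : Ty} {P : Tm (τ :: Γ) .prop} {e : Tm Γ .exp} {Q : Tm Γ (.fn .val .prop)}
    (h : Valid (Ctx.wk Θ) (holds (.triple P (Tm.wk e) (Tm.wk Q)))) :
    Valid Θ (holds (.triple (.ex τ P) e Q)) := by
  rw [valid_triple] at *
  rintro ρ w hΘ m ⟨a, hm⟩
  simpa only [Tm.denote_wk] using h _ w (hΘ.wk a) m hm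

theorem denote_cons_wk {n : ℕ} {ρ : Env Γ} (v : CVal) (σ : Fin n → Tm Γ .val) :
    (fun i => ((Fin.cons v₀ fun i => (σ i).wk : Fin (n + 1) → Tm (.val :: Γ) .val) i).denote
      (Env.cons (σ := .val) v ρ)) = (Fin.cons v fun i => (σ i).denote ρ : Fin (n + 1) → CVal) := by
  funext i
  refine Fin.cases rfl (fun i => ?_) i
  simp only [Fin.cons_succ]
  exact Tm.denote_wk _ _ _

theorem Valid.bind {k n : ℕ} (K : ECtx k n) (e : Exp k n) (σ : Fin n → Tm Γ .val)
    (τ : Fin k → Tm Γ .exp) (P : Tm Γ .prop) (Q : Tm (.val :: Γ) .prop)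
    (R : Tm (.val :: Γ) (.fn .val .prop))
    (h₁ : Valid Θ (holds (.triple P (.exp e σ τ) (.lam Q))))
    (h₂ : Valid (Ctx.wk Θ) (holds (.triple Q
      (.exp ((K.rename Fin.succ).fill (.atom (.var 0)))
        (Fin.cons v₀ fun i => (σ i).wk) fun j => (τ j).wk) R))) :
    Valid Θ (holds (.triple P (.exp (K.fill e) σ τ) (.lam (.ex .val (.app R.wk₁ v₁))))) := by
  rw [valid_triple] at *
  intro ρ w hΘ m hm
  simp only [Tm.denote, ECtx.fill_subst]
  refine wp_bind (h₁ ρ w hΘ m hm) fun w' hw' v m' hm' => ?_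
  have h := h₂ (Env.cons (σ := .val) v ρ) w' ((hΘ.mono hw').wk _) m' hm'
  simp only [Tm.denote, ECtx.fill_subst, ECtx.rename_subst, denote_cons_wk, Tm.denote_wk,
    Fin.cons_succ] at h
  -- The witness of the existential is the intermediate value `v` returned by `e`.
  refine wp_mono h fun w'' _ u m'' hm'' => ⟨v, ?_⟩
  simp only [Tm.denote_wk₁]
  exact hm''

/-- The new name stays bound to its body in all later worlds, where the premise is also available; a
triple for an application therefore follows from the one for the body by a single `β`-step. -/
theorem Valid.abs {k n : ℕ} (e : Exp k (n + 1)) (σ : Fin n → Tm Γ .val) (τ : Fin k → Tm Γ .exp)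
    (P : Tm (.val :: Γ) .prop) (Q : Tm (.val :: Γ) (.fn .val .prop))
    (h : Valid (Ctx.wk Θ) (holds (.triple P
      (.exp e (Fin.cons v₀ fun i => (σ i).wk) fun j => (τ j).wk) Q))) :
    Valid Θ (holds (.triple .emp (.exp (.lam e) σ τ)
      (.lam (.all .val (.spec (.triple P.wk₁
        (.exp (k := 0) (n := 2) (.app (.atom (.var 0)) (.atom (.var 1))) ![v₁, v₀] Fin.elim0)
        Q.wk₁)))))) := by
  rw [valid_triple] at *
  intro ρ w hΘ m _
  refine wp_lam fun w' hw' f hf v w'' hw'' m' hm' => ?_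
  simp only [Tm.denote_wk₁] at hm' ⊢
  refine wp_app (hw''.1 _ _ hf) ?_
  rw [Exp.inst_subst_liftSub]
  have h := h (Env.cons (σ := .val) v ρ) w'' ((hΘ.mono (hw'.trans hw'')).wk _) m' hm'
  simp only [Tm.denote, denote_cons_wk, Tm.denote_wk] at h
  exact h

theorem Valid.alloc (V : Tm Γ .val) : Valid Θ (holds (.triple .emp
    (.exp (k := 0) (n := 1) (.ref (.atom (.var 0))) ![V] Fin.elim0)
    (.lam (.ex .loc (.star (.eq v₁ (.ofLoc v₀)) (.pointsTo v₀ V.wk.wk)))))) := by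
  rw [valid_triple]
  intro ρ w _ m _
  -- The equation holds of every resource and takes the unit. The points-to assertion takes
  -- everything else, since it tolerates further heap cells.
  refine wp_ref (v := V.denote ρ) fun l hl =>
    ⟨l, Res.unit, ⟨m.heap.insert l (V.denote ρ), m.tr⟩, rfl, ?_, (Res.Comp.unit _).symm⟩
  simp only [Tm.denote, Tm.denote_wk]
  exact Finmap.lookup_insert _

theorem Valid.read (L : Tm Γ .loc) (V : Tm Γ .val) : Valid Θ (holds (.triple (.pointsTo L V)
    (.exp (k := 0) (n := 1) (.deref (.atom (.var 0))) ![.ofLoc L] Fin.elim0)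
    (.lam (.star (.pointsTo L.wk V.wk) (.eq v₀ V.wk))))) := by
  rw [valid_triple]
  intro ρ w _ m hm
  refine wp_deref (l := L.denote ρ) (v := V.denote ρ) hm ⟨m, Res.unit, ?_, ?_, .unit m⟩
  · simp only [Tm.denote, Tm.denote_wk]
    exact hm
  · simp only [Tm.denote, Tm.denote_wk]
    rfl

theorem Valid.write (L : Tm Γ .loc) (V : Tm Γ .val) :
    Valid Θ (holds (.triple (.ex .val (.pointsTo L.wk v₀))
      (.exp (k := 0) (n := 2) (.op .assign (.atom (.var 0)) (.atom (.var 1))) ![.ofLoc L, V]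
        Fin.elim0)
      (.lam (.star (.pointsTo L.wk V.wk) (.eq v₀ (.const (.atom .unit))))))) := by
  rw [valid_triple]
  rintro ρ w _ m ⟨u, hm⟩
  simp only [Tm.denote, Tm.denote_wk] at hm
  refine wp_assign (l := L.denote ρ) (v := V.denote ρ) (Finmap.mem_of_lookup_eq_some hm)
    ⟨⟨m.heap.insert (L.denote ρ) (V.denote ρ), m.tr⟩, Res.unit, ?_, ?_, .unit _⟩
  · simp only [Tm.denote, Tm.denote_wk]
    exact Finmap.lookup_insert _
  · exact (Tm.denote_const _ _).symm

theorem Valid.opEq (U V : Tm Γ .val) : Valid Θ (holds (.triple .emp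
    (.exp (k := 0) (n := 2) (.op .eq (.atom (.var 0)) (.atom (.var 1))) ![U, V] Fin.elim0)
    (.lam (.or
      (.and (.eq U.wk V.wk) (.eq v₀ (.const (.atom (.int 1)))))
      (.and (.imp (.eq U.wk V.wk) .bot) (.eq v₀ (.const (.atom (.int 0))))))))) := by
  rw [valid_triple]
  intro ρ w _ m _
  refine wp_eq (u := U.denote ρ) (v := V.denote ρ) (fun h => ?_) fun h => ?_
  · simp only [Tm.denote, Tm.denote_wk]
    exact .inl ⟨h, (Tm.denote_const _ _).symm⟩
  · simp only [Tm.denote, Tm.denote_wk]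
    exact .inr ⟨fun _ _ h' => h h', (Tm.denote_const _ _).symm⟩

theorem Valid.emit (t : Tm Γ .trace) (V : Tm Γ .val) (I : Tm Γ (.fn .trace .bool))
    (h : Valid Θ (holds (.eq (.app I (t.snoc V)) .tt))) :
    Valid Θ (holds (.triple (.star (.trace t) (.inv I))
      (.exp (k := 0) (n := 1) (.emit (.atom (.var 0))) ![V] Fin.elim0)
      (.lam (.star (.trace (t.wk.snoc V.wk)) (.eq v₀ (.const (.atom .unit))))))) := by
  rw [valid_triple]
  rintro ρ w hΘ m ⟨m₁, m₂, h₁, h₂, hc⟩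
  -- By maximality of owned traces, the part `m₁` owning the trace forces `m` to own the same trace.
  have hm : m.tr = .own (t.denote ρ) := TraceRes.own_le.1 (le_trans h₁ ⟨_, hc.tr⟩)
  have hI := h ρ w hΘ
  change (I.denote ρ) ((t.snoc V).denote ρ) = true at hI
  rw [Tm.denote_snoc] at hI
  refine wp_emit (t := t.denote ρ) (v := V.denote ρ) hm ?_
    ⟨⟨m.heap, .own (t.denote ρ ++ [V.denote ρ])⟩, Res.unit, ?_, ?_, .unit _⟩
  -- The assertion `inv I` identifies the invariant of the world with the set decided by `I`.
  · rw [show w.inv = _ from h₂]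
    exact hI
  · simp only [Tm.denote, Tm.denote_snoc, Tm.denote_wk]
    exact le_refl (TraceRes.own _)
  · exact (Tm.denote_const _ _).symm

end Triples
-- Soundness of the logic
open Concl

/-- Soundness: derivable judgements are valid. -/
theorem Derivable.sound {Γ : List Ty} {Θ : List (Tm Γ .spec)} {J : Concl Γ}
    (h : Derivable Γ Θ J) : Valid Θ J := by
  induction h with
  | hyp h => exact fun ρ w hΘ => hΘ _ h
  | cut _ _ ih₁ ih₂ => exact fun ρ w hΘ => ih₂ ρ w (hΘ.cons (ih₁ ρ w hΘ))
  | weaken h _ ih => exact fun ρ w hΘ => ih ρ w fun S hS => hΘ S (h hS)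
  | subst θ _ ih => exact ih.subst θ
  | topI => exact fun _ _ _ => trivial
  | botE _ ih => exact fun ρ w hΘ => (ih ρ w hΘ).elim
  | andI _ _ ih₁ ih₂ => exact fun ρ w hΘ => ⟨ih₁ ρ w hΘ, ih₂ ρ w hΘ⟩
  | andE₁ _ ih => exact fun ρ w hΘ => (ih ρ w hΘ).1
  | andE₂ _ ih => exact fun ρ w hΘ => (ih ρ w hΘ).2
  | orI₁ _ ih => exact fun ρ w hΘ => .inl (ih ρ w hΘ)
  | orI₂ _ ih => exact fun ρ w hΘ => .inr (ih ρ w hΘ)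
  | orE _ _ _ ih ih₁ ih₂ =>
    exact fun ρ w hΘ => (ih ρ w hΘ).elim (fun h => ih₁ ρ w (hΘ.cons h))
      fun h => ih₂ ρ w (hΘ.cons h)
  | impI _ ih => exact fun ρ w hΘ w' hw h => ih ρ w' ((hΘ.mono hw).cons h)
  | impE _ _ ih₁ ih₂ => exact fun ρ w hΘ => ih₁ ρ w hΘ w le_rfl (ih₂ ρ w hΘ)
  | allI _ ih => exact fun ρ w hΘ a => ih _ w (hΘ.wk a)
  | allE M _ ih =>
    intro ρ w hΘ
    simp only [Concl.Sat, Tm.denote_inst]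
    exact ih ρ w hΘ _
  | exI M _ ih =>
    intro ρ w hΘ
    have := ih ρ w hΘ
    simp only [Concl.Sat, Tm.denote_inst] at this
    exact ⟨_, this⟩
  | exE _ _ ih ih₁ =>
    intro ρ w hΘ
    obtain ⟨a, ha⟩ := ih ρ w hΘ
    exact (Concl.sat_wk _ a ρ w).1 (ih₁ _ w ((hΘ.wk a).cons ha))
  | eqRefl M => exact fun _ _ _ => rfl
  | eqSubst J _ _ ih ih₁ =>
    intro ρ w hΘ
    have h := ih₁ ρ w hΘ
    rw [Concl.sat_subst, Env.one] at h ⊢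
    rwa [← show _ = _ from ih ρ w hΘ]
  | funExt _ ih =>
    intro ρ w hΘ
    refine funext fun a => ?_
    have h := ih _ w (hΘ.wk a)
    change Tm.denote _ _ = Tm.denote _ _ at h
    simp only [Tm.denote, Tm.denote_wk] at h
    exact h
  | specExt _ _ ih₁ ih₂ =>
    intro ρ w _
    -- Equality of denotations concerns every world, not only those satisfying `Θ`; the rule drops
    -- `Θ` from its premises for this reason.
    refine UpperSet.ext (Set.ext fun w' => ⟨fun h => ?_, fun h => ?_⟩)
    · exact ih₁ ρ w' (List.forall_mem_singleton.2 h)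
    · exact ih₂ ρ w' (List.forall_mem_singleton.2 h)
  | propExt _ _ ih₁ ih₂ =>
    intro ρ w _
    refine UpperSet.ext (Set.ext fun ⟨w', m⟩ => ⟨fun h => ?_, fun h => ?_⟩)
    · exact ih₁ ρ w' (List.forall_mem_nil _) m h
    · exact ih₂ ρ w' (List.forall_mem_nil _) m h
  | beta M N => exact fun ρ _ _ => (Tm.denote_inst M N ρ).symm
  | unitEta M => exact fun _ _ _ => rfl
  | fstPair M N => exact fun _ _ _ => rfl
  | sndPair M N => exact fun _ _ _ => rfl
  | pairEta M => exact fun _ _ _ => rfl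
  | condTrue M N => exact fun _ _ _ => rfl
  | condFalse M N => exact fun _ _ _ => rfl
  | boolNe _ ih => exact fun ρ w hΘ => Bool.noConfusion (ih ρ w hΘ)
  | boolCases S M _ _ ih₁ ih₂ =>
    intro ρ w hΘ
    have h₁ := ih₁ ρ w hΘ
    have h₂ := ih₂ ρ w hΘ
    simp only [Concl.Sat, Tm.denote_inst, Tm.denote] at h₁ h₂ ⊢
    generalize M.denote ρ = b
    cases b
    · exact h₂
    · exact h₁
  | foldNil N₁ N₂ => exact fun _ _ _ => rfl
  | foldCons M N N₁ N₂ => exact fun _ _ _ => rfl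
  | consNe _ ih => exact fun ρ w hΘ => List.cons_ne_nil _ _ (ih ρ w hΘ).symm
  | consInj₁ _ ih => exact fun ρ w hΘ => (List.cons.inj (ih ρ w hΘ)).1
  | consInj₂ _ ih => exact fun ρ w hΘ => (List.cons.inj (ih ρ w hΘ)).2
  | @seqInd Γ Θ τ S M _ _ ih₁ ih₂ =>
    intro ρ w hΘ
    have h₁ := ih₁ ρ w hΘ
    simp only [Concl.Sat, Tm.denote_inst, Tm.denote] at h₁ ⊢
    generalize M.denote ρ = l
    change List τ.denote at l
    -- The induction runs at a fixed world: the hypothesis for the tail becomes the assumption added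
    -- to the context of the second premise.
    induction l with
    | nil => exact h₁
    | cons a l ih =>
      have h₂ := ih₂ (Env.cons a (Env.cons (σ := .seq τ) l ρ)) w
        (((hΘ.wk (σ := .seq τ) l).wk a).cons (by rw [Tm.denote_wk]; exact ih))
      simp only [Concl.Sat, Tm.denote_inst, Tm.denote_wk₁] at h₂
      exact h₂
  | valVar i σ => exact fun _ _ _ => rfl
  | valSubst v δ σ => exact fun _ _ _ => v.subst_subst _ _
  | expVar j σ τ => exact fun _ _ _ => rfl
  | expSubst e δ ε σ τ => exact fun _ _ _ => e.subst_subst _ _ _ _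
  | constNe huv _ ih =>
    intro ρ w hΘ
    have h : Tm.denote _ ρ = Tm.denote _ ρ := ih ρ w hΘ
    rw [Tm.denote_const, Tm.denote_const] at h
    exact huv h
  | pairInj i _ ih =>
    intro ρ w hΘ
    have h := Val.pair.inj (ih ρ w hΘ)
    fin_cases i
    · exact h.1
    · exact h.2
  | @pairNe _ _ U a _ ih =>
    intro ρ w hΘ
    have h : Val.pair _ _ = Tm.denote (.const (.atom a)) ρ := ih ρ w hΘ
    rw [Tm.denote_const] at h
    cases h
  | locInj _ ih => exact fun ρ w hΘ => Atom.loc.inj (Val.atom.inj (ih ρ w hΘ))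
  | aId P => exact fun _ _ _ _ h => h
  | aTrans _ _ ih₁ ih₂ => exact fun ρ w hΘ m h => ih₂ ρ w hΘ m (ih₁ ρ w hΘ m h)
  | aTop P => exact fun _ _ _ _ _ => trivial
  | aBot P => exact fun _ _ _ _ h => False.elim h
  | aAndI _ _ ih₁ ih₂ => exact fun ρ w hΘ m h => ⟨ih₁ ρ w hΘ m h, ih₂ ρ w hΘ m h⟩
  | aAndE₁ P Q => exact fun _ _ _ _ h => h.1
  | aAndE₂ P Q => exact fun _ _ _ _ h => h.2
  | aOrI₁ P Q => exact fun _ _ _ _ h => .inl h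
  | aOrI₂ P Q => exact fun _ _ _ _ h => .inr h
  | aOrE _ _ ih₁ ih₂ => exact fun ρ w hΘ m h => h.elim (ih₁ ρ w hΘ m) (ih₂ ρ w hΘ m)
  | @aImpI Γ Θ P Q R _ ih =>
    exact fun ρ w hΘ m h ⟨w', m'⟩ hle h' =>
      ih ρ w' (hΘ.mono hle.1) m' ⟨(P.denote ρ : SProp).upper hle h, h'⟩
  | aImpE _ ih => exact fun ρ w hΘ m h => ih ρ w hΘ m h.1 (w, m) le_rfl h.2
  | aAllI _ ih =>
    intro ρ w hΘ m h a
    exact ih _ w (hΘ.wk a) m (by rwa [Tm.denote_wk])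
  | aAllE Q M =>
    intro ρ w _ m h
    rw [Tm.denote_inst]
    exact h _
  | aExI Q M =>
    intro ρ w _ m h
    rw [Tm.denote_inst] at h
    exact ⟨_, h⟩
  | aExE _ ih =>
    rintro ρ w hΘ m ⟨a, h⟩
    have := ih _ w (hΘ.wk a) m h
    rwa [Tm.denote_wk] at this
  | aEqRefl P M => exact fun _ _ _ _ _ => rfl
  | aEqSubst Q _ _ ih ih₁ =>
    intro ρ w hΘ m h
    have h₁ := ih₁ ρ w hΘ m h
    rw [Tm.denote_inst] at h₁ ⊢
    rwa [← show _ = _ from ih ρ w hΘ m h]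
  | starMono _ _ ih₁ ih₂ =>
    rintro ρ w hΘ m ⟨m₁, m₂, h₁, h₂, hc⟩
    exact ⟨m₁, m₂, ih₁ ρ w hΘ m₁ h₁, ih₂ ρ w hΘ m₂ h₂, hc⟩
  | starComm P Q =>
    rintro ρ w _ m ⟨m₁, m₂, h₁, h₂, hc⟩
    exact ⟨m₂, m₁, h₂, h₁, hc.symm⟩
  | starAssoc P Q R =>
    rintro ρ w _ m ⟨m₁, m₂, ⟨m₃, m₄, h₃, h₄, hc'⟩, h₂, hc⟩
    obtain ⟨x, hx, hx'⟩ := hc'.assoc hc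
    exact ⟨m₃, x, h₃, ⟨m₄, m₂, h₄, h₂, hx⟩, hx'⟩
  | starEmpI P => exact fun ρ w _ m h => ⟨m, Res.unit, h, trivial, .unit m⟩
  | starEmpE P =>
    rintro ρ w _ m ⟨m₁, m₂, h₁, _, hc⟩
    exact (P.denote ρ : SProp).upper (a := (w, m₁)) ⟨le_rfl, _, hc⟩ h₁
  | empI P => exact fun _ _ _ _ _ => trivial
  | @wandI Γ Θ P Q R _ ih =>
    exact fun ρ w hΘ m h w' hw m' hm m'' c hc h' =>
      ih ρ w' (hΘ.mono hw) c
        ⟨m', m'', (P.denote ρ : SProp).upper (a := (w, m)) ⟨hw, hm⟩ h, h', hc⟩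
  | wandE _ ih =>
    rintro ρ w hΘ m ⟨m₁, m₂, h₁, h₂, hc⟩
    exact ih ρ w hΘ m₁ h₁ w le_rfl m₁ le_rfl m₂ m hc h₂
  | pointsToExcl M N N' =>
    rintro ρ w _ m ⟨m₁, m₂, h₁, h₂, hc⟩
    exact hc.disj _ (Finmap.mem_of_lookup_eq_some h₁) (Finmap.mem_of_lookup_eq_some h₂)
  | pSpec P S => exact fun ρ w hΘ m _ => hΘ _ List.mem_cons_self
  | pSpecE _ ih => exact fun ρ w hΘ m h => ih ρ w (hΘ.cons h.2) m h.1
  | pValid P Q => exact fun ρ w hΘ m _ => hΘ _ List.mem_cons_self m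
  | valid _ ih => exact fun ρ w hΘ m => ih ρ w hΘ m trivial
  | traceExcl t₁ t₂ =>
    rintro ρ w _ m ⟨m₁, m₂, h₁, h₂, hc⟩
    have ht := hc.tr
    rw [TraceRes.own_le.1 h₁, TraceRes.own_le.1 h₂] at ht
    -- Two owned traces have no product.
    cases ht
  -- `inv I` depends on the world alone, so the unit also satisfies it.
  | pInvDupl I => exact fun ρ w _ m h => ⟨m, Res.unit, h, h, .unit m⟩
  | pHistDupl t =>
    exact fun ρ w _ m h => ⟨m, ⟨∅, .hist (t.denote ρ)⟩, h, le_refl (TraceRes.hist _),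
      (Res.Comp.unit m).disj, (Res.Comp.unit m).heap, TraceRes.comp_hist h⟩
  | pAllocHist t =>
    intro ρ w _ m h
    refine ⟨m, ⟨∅, .hist (t.denote ρ)⟩, h, le_refl (TraceRes.hist _),
      (Res.Comp.unit m).disj, (Res.Comp.unit m).heap, ?_⟩
    rw [TraceRes.own_le.1 h]
    exact .ownL List.prefix_rfl
  | pUseHist t₁ t₂ =>
    rintro ρ w _ m ⟨m₁, m₂, h₁, h₂, hc⟩
    -- The prefix assertion is independent of the resource, so the original splitting can be kept.
    refine ⟨m₁, m₂, h₁, (Tm.mem_denote_pref _ _ _ _).2 ?_, hc⟩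
    have ht := hc.tr
    rw [TraceRes.own_le.1 h₁] at ht
    obtain ⟨-, t', ht', hp⟩ := ht.own_inv
    refine List.IsPrefix.trans ?_ hp
    have h : TraceRes.hist (t₂.denote ρ) ≤ m₂.tr := h₂
    rw [ht'] at h
    exact TraceRes.hist_le_hist.1 h
  | specOut _ ih => exact ih.specOut
  | frame R _ ih => exact ih.frame R
  | csq _ _ _ ih₁ ih₂ ih₃ => exact ih₁.csq ih₂ ih₃
  | exPre _ ih => exact ih.exPre
  | bind K e σ τ P Q R _ _ ih₁ ih₂ => exact ih₁.bind K e σ τ P Q R ih₂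
  | ret V =>
    rw [valid_triple]
    refine fun ρ w _ m _ => wp_value (v := V.denote ρ) ?_
    simp only [Tm.denote, Tm.denote_wk]
    rfl
  | abs e σ τ P Q _ ih => exact ih.abs e σ τ P Q
  | proj i V =>
    rw [valid_triple]
    refine fun ρ w _ m _ => wp_proj (v := fun i => (V i).denote ρ) ?_
    simp only [Tm.denote, Tm.denote_wk]
    rfl
  | itePos z hz e₁ e₂ σ τ P Q _ ih =>
    rw [valid_triple] at *
    exact fun ρ w hΘ m hm => wp_itePos hz (ih ρ w hΘ m hm)
  | iteZero e₁ e₂ σ τ P Q _ ih =>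
    rw [valid_triple] at *
    exact fun ρ w hΘ m hm => wp_iteZero (ih ρ w hΘ m hm)
  | alloc V => exact Valid.alloc V
  | read L V => exact Valid.read L V
  | write L V => exact Valid.write L V
  | opEq U V => exact Valid.opEq U V
  | opAdd a b =>
    rw [valid_triple]
    exact fun ρ w _ m _ => wp_add (Tm.denote_const _ _).symm
  | opSub a b =>
    rw [valid_triple]
    exact fun ρ w _ m _ => wp_sub (Tm.denote_const _ _).symm
  | opMul a b =>
    rw [valid_triple]
    exact fun ρ w _ m _ => wp_mul (Tm.denote_const _ _).symm
  | emit t V I _ ih => exact ih.emit t V I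

end TraceLogic

/-! ### Adequacy of the logic -/

open TraceLogic

theorem mainTheorem3 {Γ : List Ty} (P : Tm Γ .prop) (e : Tm Γ .exp) (Q : Tm Γ (.fn .val .prop))
    (hder : Derivable Γ [] (.holds (.triple P e Q)))
    (w : World) (ρ : Env Γ) (m : Res) (hm : (w, m) ∈ (P.denote ρ : SProp))
    (t : Trace) (s : State) (hs : Erases t s w m)
    (t' : Trace) (e' : CExp) (s' : State)
    (hred : Steps (e.denote ρ) s t' e' s') (hirr : Irreducible e' s') :
    ∃ v : CVal, e' = v.toExp ∧
      ∃ w' ≥ w, ∃ m' : Res, (w', m') ∈ (Q.denote ρ v : SProp) ∧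
        Erases (t ++ t') s' w' m' ∧ t ++ t' ∈ w.inv := by
  have hwp := valid_triple.1 hder.sound ρ w (List.forall_mem_nil _) m hm
  -- Adequacy is used with the erased resource `m` itself as frame-free resource: the frame is the
  -- unit.
  obtain ⟨v, hv, w', hw', m', hQ, c, hc, hs'⟩ := wp_adequacy hred hirr hwp ⟨m, .unit m, hs⟩
  refine ⟨v, hv, w', hw', c, ?_, hs', ?_⟩
  -- Erasure is known for `c = m' • Res.unit`, which lies above `m'` and so satisfies the
  -- postcondition too.
  · exact (Q.denote ρ v : SProp).upper (a := (w', m')) ⟨le_rfl, _, hc⟩ hQ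
  · rw [hw'.2]
    exact hs'.2.2.2
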